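/- Let $A$ be a free abelian group that is not finitely generated, and let $\operatorname{Aut} A$ be its automorphism group. Call a direct summand $W$ of $A$ \emph{moietous} if both its rank and its corank (the rank of $A/W$, equivalently of any complement of $W$) are equal to $\operatorname{rank} A$, and call a direct summand $L$ of $A$ \emph{large} if its corank is strictly less than $\operatorname{rank} A$. For a natural number $m$ let $\Lambda_A(m)$ be the set of all $\varphi\in\operatorname{Aut} A$ for which there are an integer $k$ and a large direct summand $L$ of $A$ such that $\varphi(x)-kx\in mA$ for all $x\in L$. Call $\varphi\in\operatorname{Aut} A$ a \emph{normal generator} of $\operatorname{Aut} A$ if the normal closure of $\{\varphi\}$ in $\operatorname{Aut} A$ is the whole group. Then for every $\varphi\in\operatorname{Aut} A$: (1) $\varphi$ is a normal generator of $\operatorname{Aut} A$ if and only if there is a moietous direct summand $W$ of $A$ such that $W\cap\varphi(W)=\{0\}$ and $W\oplus\varphi(W)$ is a direct summand of $A$; (2) if $\varphi$ is not a normal generator of $\operatorname{Aut} A$, then $\varphi\in\Lambda_A(m)$ for some natural number $m\ge 2$. -/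

import Mathlib

/-! An abelian group is a `ℤ`-module: its subgroups are the terms of `Submodule ℤ A`, and its
automorphism group is `A ≃ₗ[ℤ] A`, a group under composition. -/

/-- `W` is a direct summand of the abelian group `A`: it has a complementary subgroup. -/
def IsDirectSummand {A : Type*} [AddCommGroup A] (W : Submodule ℤ A) : Prop :=
  ∃ V : Submodule ℤ A, IsCompl W V

/-- The corank of a subgroup `W` of an abelian group `A`: the rank of `A / W`. When `W` is a direct
summand, `A / W` is isomorphic to every complement of `W`. -/
noncomputable def corank {A : Type*} [AddCommGroup A] (W : Submodule ℤ A) : Cardinal :=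
  Module.rank ℤ (A ⧸ W)

/-- A direct summand is moietous if both its rank and its corank are equal to the rank of `A`. -/
def IsMoietous {A : Type*} [AddCommGroup A] (W : Submodule ℤ A) : Prop :=
  IsDirectSummand W ∧ Module.rank ℤ W = Module.rank ℤ A ∧ corank W = Module.rank ℤ A

/-- A direct summand is large if its corank is strictly less than the rank of `A`. -/
def IsLarge {A : Type*} [AddCommGroup A] (L : Submodule ℤ A) : Prop :=
  IsDirectSummand L ∧ corank L < Module.rank ℤ A

/-- `Λ_A(m)`: the automorphisms `φ` of `A` for which there are an integer `k` and a large direct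
summand `L` of `A` with `φ x ≡ k x (mod mA)` for all `x ∈ L`. -/
def Lam (A : Type*) [AddCommGroup A] (m : ℕ) : Set (A ≃ₗ[ℤ] A) :=
  {φ | ∃ (k : ℤ) (L : Submodule ℤ A), IsLarge L ∧ ∀ x ∈ L, ∃ y : A, φ x = k • x + m • y}

/-- `φ` is a normal generator of the group `G`: its normal closure is the whole of `G`. -/
def IsNormalGenerator {G : Type*} [Group G] (φ : G) : Prop :=
  Subgroup.normalClosure {φ} = ⊤

-- The obstructions to normal generation are congruences. For a prime `p`, the automorphisms that
-- act as a scalar modulo `p` on some large summand form a normal subgroup (`scalarModOnLarge`). It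
-- is proper, because it misses the swap of the two halves of `A ≅ A × A`. A normal generator
-- therefore avoids all of these subgroups.
--
-- Conversely, suppose `φ` avoids them all. Given fewer coordinates than the rank, there is a vector
-- `w` such that `w` and `φ w` are unimodular as a pair outside those coordinates
-- (`exists_unimodularPair`). A transfinite recursion collects rank-many such pairs. They form a
-- unitriangular system, so the vectors `w` span a moietous summand that `φ` moves to an independent
-- one, which is `MovesSummand φ`.
--
-- It remains to see that `MovesSummand φ` makes `φ` a normal generator. Write `A` as three copies
-- of itself, with `φ` carrying the first copy identically onto the second. In the normal closure of
-- `φ`, commutators produce every automorphism of the first copy. Further commutators produce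
-- transvections, and an Eilenberg swindle gives all automorphisms of the complement. So the whole
-- pointwise stabilizer of the first copy lies in the closure (`mem_normal_of_fixes_of_maps`). Any
-- other moving automorphism is, up to conjugacy, `φ` times an element of this stabilizer, and every
-- automorphism is a product of two moving ones (`exists_mul_eq_movesSummand`).
--
-- All of this works over a principal ideal domain; the integers enter only at the end.

universe u v w

/-! ### Kernels and submodules of free modules over a principal ideal domain. -/

/-- A submodule of a free module over a principal ideal domain is free. -/
theorem Submodule.free_of_isPrincipalIdealRing {R M : Type*} [CommRing R] [IsDomain R]
    [IsPrincipalIdealRing R] [AddCommGroup M] [Module R M] [Module.Free R M]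
    (N : Submodule R M) : Module.Free R N := by
  classical
  let ι := Module.Free.ChooseBasisIndex R M
  let b : Module.Basis ι R M := Module.Free.chooseBasis R M
  obtain ⟨lo, wf⟩ := exists_wellFoundedLT ι
  -- `V i` is the part of `N` supported on indices up to `i`, and `I i` is the ideal of its
  -- coordinates at `i`. Lifts `x i` of the nonzero generators `d i` form the basis.
  let V : ι → Submodule R M := fun i =>
    N ⊓ (Finsupp.supported R R (Set.Iic i)).comap b.repr.toLinearMap
  have hV : ∀ i y, y ∈ V i ↔ y ∈ N ∧ ∀ j, i < j → b.repr y j = 0 := fun i y => by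
    simp only [V, Submodule.mem_inf, Submodule.mem_comap, Finsupp.mem_supported']
    simp
  let I : ι → Ideal R := fun i => (V i).map (b.coord i)
  let d : ι → R := fun i => Submodule.IsPrincipal.generator (I i)
  have hd : ∀ i, ∃ x ∈ V i, b.repr x i = d i := fun i => by
    have h : d i ∈ I i := Submodule.IsPrincipal.generator_mem _
    simpa [I] using h
  choose x hxV hxd using hd
  have hx0 : ∀ i j, i < j → b.repr (x i) j = 0 := fun i => ((hV i _).1 (hxV i)).2
  let J := {i // d i ≠ 0}
  let z : J → N := fun i => ⟨x i, ((hV _ _).1 (hxV i)).1⟩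
  have hspan : ∀ i, ∀ y (hy : y ∈ V i), (⟨y, hy.1⟩ : N) ∈ Submodule.span R (Set.range z) := by
    intro i
    induction i using WellFoundedLT.induction with
    | _ i ih =>
      intro y hy
      have hyI : b.repr y i ∈ I i := ⟨y, hy, by simp⟩
      obtain ⟨r, hr⟩ := (Submodule.IsPrincipal.mem_iff_eq_smul_generator (I i)).1 hyI
      have hrest : ∀ u (hu : u ∈ V i), b.repr u i = 0 →
          (⟨u, hu.1⟩ : N) ∈ Submodule.span R (Set.range z) := by
        intro u hu hui
        by_cases h0 : u = 0
        · have : (⟨u, hu.1⟩ : N) = 0 := Subtype.ext h0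
          rw [this]; exact Submodule.zero_mem _
        have hs : (b.repr u).support.Nonempty := by
          rw [Finsupp.support_nonempty_iff]; simpa using h0
        set j := (b.repr u).support.max' hs
        have hj : b.repr u j ≠ 0 := Finsupp.mem_support_iff.1 (Finset.max'_mem _ hs)
        have hji : j < i := by
          rcases lt_trichotomy j i with h | h | h
          · exact h
          · exact absurd (h ▸ hui) hj
          · exact absurd (((hV i u).1 hu).2 j h) hj
        refine ih j hji u ((hV j u).2 ⟨hu.1, fun k hk => ?_⟩)
        by_contra hne
        exact absurd (Finset.le_max' _ _ (Finsupp.mem_support_iff.2 hne)) (not_le.2 hk)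
      by_cases hdi : d i = 0
      · exact hrest y hy (by rw [hr]; change r • d i = 0; rw [hdi, smul_zero])
      · have hu : y - r • x i ∈ V i := Submodule.sub_mem _ hy (Submodule.smul_mem _ _ (hxV i))
        have h1 := hrest _ hu (by
          rw [map_sub, map_smul, Finsupp.sub_apply, Finsupp.smul_apply, hxd, hr]
          exact sub_self _)
        have h2 : (⟨y, hy.1⟩ : N) = ⟨y - r • x i, hu.1⟩ + r • z ⟨i, hdi⟩ :=
          Subtype.ext (by simp [z])
        rw [h2]
        exact Submodule.add_mem _ h1
          (Submodule.smul_mem _ _ (Submodule.subset_span (Set.mem_range_self _)))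
  have hind : LinearIndependent R z := by
    rw [linearIndependent_iff]
    intro l hl
    by_contra hne
    have hs : l.support.Nonempty := Finsupp.support_nonempty_iff.2 hne
    set i := l.support.max' hs
    have hli : l i ≠ 0 := Finsupp.mem_support_iff.1 (Finset.max'_mem _ hs)
    have h1 : b.repr ((Finsupp.linearCombination R z l : N) : M) i = l i * d i := by
      rw [Finsupp.linearCombination_apply, Finsupp.sum, Submodule.coe_sum, map_sum,
        Finsupp.finsetSum_apply, Finset.sum_eq_single i]
      · simp [z, hxd]
      · intro j hj hji
        have : (j : ι) < i := lt_of_le_of_ne (Finset.le_max' _ _ hj) fun h => hji (Subtype.ext h)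
        simp [z, hx0 _ _ this]
      · intro h
        simp [Finsupp.notMem_support_iff.1 h]
    rw [hl] at h1
    have h2 : l i * d i = 0 := by rw [← h1]; simp
    exact (mul_ne_zero hli i.2) h2
  refine Module.Free.of_basis (Module.Basis.mk hind ?_)
  rintro ⟨y, hy⟩ -
  by_cases h0 : y = 0
  · have : (⟨y, hy⟩ : N) = 0 := Subtype.ext h0
    rw [this]; exact Submodule.zero_mem _
  have hs : (b.repr y).support.Nonempty := by
    rw [Finsupp.support_nonempty_iff]; simpa using h0
  exact hspan ((b.repr y).support.max' hs) y ((hV _ _).2 ⟨hy, fun k hk => by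
    by_contra hne
    exact absurd (Finset.le_max' _ _ (Finsupp.mem_support_iff.2 hne)) (not_le.2 hk)⟩)

/-- The kernel of a homomorphism into a free module has a projection onto it. -/
theorem exists_projection_ker {R : Type v} [CommRing R] [IsDomain R] [IsPrincipalIdealRing R]
    {B : Type u} {C : Type w} [AddCommGroup B] [Module R B]
    [AddCommGroup C] [Module R C] [Module.Free R C] (h : B →ₗ[R] C) :
    ∃ π : B →ₗ[R] LinearMap.ker h, ∀ x : LinearMap.ker h, π x = x := by
  have hfree : Module.Free R (LinearMap.range h) := Submodule.free_of_isPrincipalIdealRing _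
  obtain ⟨s, hs⟩ := Module.projective_lifting_property h.rangeRestrict LinearMap.id
    h.surjective_rangeRestrict
  have hp : ∀ x, x - s (h.rangeRestrict x) ∈ LinearMap.ker h := fun x => by
    have h1 : h.rangeRestrict (s (h.rangeRestrict x)) = h.rangeRestrict x :=
      LinearMap.congr_fun hs _
    have h2 := congrArg Subtype.val h1
    change h (s (h.rangeRestrict x)) = h x at h2
    simp [h2]
  refine ⟨(LinearMap.id - s ∘ₗ h.rangeRestrict).codRestrict _ (fun x => hp x), fun x => ?_⟩
  ext
  have h0 : h.rangeRestrict (x : B) = 0 := Subtype.ext x.2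
  simp [h0]

/-- The kernel of a homomorphism into a free module of smaller rank contains a vector that some
linear functional maps to `1`. -/
theorem exists_unimodular_mem_ker {R : Type v} [CommRing R] [IsDomain R] [IsPrincipalIdealRing R]
    {B : Type u} {C : Type w} [AddCommGroup B] [Module R B] [Module.Free R B]
    [AddCommGroup C] [Module R C] [Module.Free R C] (h : B →ₗ[R] C)
    (hr : Cardinal.lift.{u} (Module.rank R C) < Cardinal.lift.{w} (Module.rank R B)) :
    ∃ w, h w = 0 ∧ ∃ l : B →ₗ[R] R, l w = 1 := by
  obtain ⟨π, hπ⟩ := exists_projection_ker h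
  have hne : Nontrivial (LinearMap.ker h) := by
    rw [Submodule.nontrivial_iff_ne_bot]
    intro hbot
    exact absurd (LinearMap.lift_rank_le_of_injective h (LinearMap.ker_eq_bot.1 hbot))
      (not_le.2 hr)
  have hfree : Module.Free R (LinearMap.ker h) := Submodule.free_of_isPrincipalIdealRing _
  let b := Module.Free.chooseBasis R (LinearMap.ker h)
  obtain ⟨i⟩ : Nonempty (Module.Free.ChooseBasisIndex R (LinearMap.ker h)) := b.index_nonempty
  exact ⟨b i, (b i).2, b.coord i ∘ₗ π, by simp [hπ]⟩

/-- The corank of the kernel of a homomorphism is at most the rank of the codomain. -/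
theorem lift_rank_quotient_ker_le {R : Type v} [CommRing R] [IsDomain R]
    {B : Type u} {C : Type w} [AddCommGroup B] [Module R B]
    [AddCommGroup C] [Module R C] (h : B →ₗ[R] C) :
    Cardinal.lift.{w} (Module.rank R (B ⧸ LinearMap.ker h)) ≤
      Cardinal.lift.{u} (Module.rank R C) := by
  rw [LinearEquiv.lift_rank_eq h.quotKerEquivRange, Cardinal.lift_le]
  exact Submodule.rank_le _

/-! ### Transfinite recursion and unitriangular maps. -/

/-- If every set `S` smaller than `ι` admits some `x` with `P S x`, then along a suitable well-order
of `ι` there is a family whose members satisfy `P` relative to the union of the finite sets attached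
to all earlier members. -/
theorem exists_wellOrder_family {ι X : Type u} [Infinite ι] (P : Set ι → X → Prop)
    (T : X → Finset ι) (hP : ∀ S : Set ι, Cardinal.mk S < Cardinal.mk ι → ∃ x, P S x) :
    ∃ (_ : LinearOrder ι) (_ : WellFoundedLT ι) (x : ι → X),
      ∀ i, P {t | ∃ j < i, t ∈ T (x j)} (x i) := by
  classical
  -- The order type is the initial ordinal of `#ι`, so proper initial segments are smaller than `ι`.
  -- The union of finite sets over such a segment is then still smaller than `ι`.
  obtain ⟨e⟩ : Nonempty (ι ≃ (Cardinal.mk ι).ord.ToType) := Cardinal.eq.1 (by simp)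
  have hX : Nonempty X := by
    obtain ⟨x, -⟩ := hP ∅ (by simp [pos_iff_ne_zero])
    exact ⟨x⟩
  let lo : LinearOrder ι := LinearOrder.lift' e e.injective
  have wf : WellFoundedLT ι := ⟨InvImage.wf e wellFounded_lt⟩
  have hIio : ∀ i : ι, Cardinal.mk (Set.Iio i) < Cardinal.mk ι := fun i => by
    have h1 : Cardinal.mk (Set.Iio (e i)) < Cardinal.mk ι := by
      simpa using Cardinal.mk_Iio_lt (e i)
    refine lt_of_le_of_lt ?_ h1
    exact Cardinal.mk_le_of_injective (f := fun j : Set.Iio i => (⟨e j, j.2⟩ : Set.Iio (e i)))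
      (fun a b hab => Subtype.ext (e.injective (congrArg Subtype.val hab)))
  let F : Set ι → X := fun S => if h : ∃ x, P S x then h.choose else Classical.arbitrary X
  have hF : ∀ S : Set ι, Cardinal.mk S < Cardinal.mk ι → P S (F S) := fun S hS => by
    simp only [F, dif_pos (hP S hS)]
    exact (hP S hS).choose_spec
  let x : ι → X := wf.wf.fix fun i rec => F {t | ∃ (j : ι) (h : j < i), t ∈ T (rec j h)}
  have hx : ∀ i, x i = F {t | ∃ j < i, t ∈ T (x j)} := fun i => by
    simp only [x]
    rw [WellFounded.fix_eq]
    simp only [exists_prop]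
  refine ⟨lo, wf, x, fun i => ?_⟩
  rw [hx i]
  apply hF
  have hU : {t | ∃ j < i, t ∈ T (x j)} = ⋃ j : Set.Iio i, (T (x j) : Set ι) := by
    ext t; simp
  rw [hU]
  rcases lt_or_ge (Cardinal.mk (Set.Iio i)) Cardinal.aleph0 with hfin | hinf
  · have : Finite (Set.Iio i) := Cardinal.lt_aleph0_iff_finite.1 hfin
    have : (⋃ j : Set.Iio i, (T (x j) : Set ι)).Finite :=
      Set.finite_iUnion fun j => Finset.finite_toSet _
    exact lt_of_lt_of_le (Set.Finite.lt_aleph0 this) (Cardinal.aleph0_le_mk ι)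
  · refine lt_of_le_of_lt (Cardinal.mk_iUnion_le _) (lt_of_le_of_lt ?_ (hIio i))
    refine (mul_le_mul' le_rfl (ciSup_le' (a := Cardinal.aleph0) fun j => ?_)).trans ?_
    · exact (Finset.finite_toSet _).lt_aleph0.le
    · rw [Cardinal.mul_aleph0_eq hinf]

/-- A unitriangular endomorphism of a direct sum indexed by a well-order is bijective. -/
theorem bijective_of_unitriangular {R M ι : Type*} [CommRing R] [AddCommGroup M] [Module R M]
    [LinearOrder ι] [WellFoundedLT ι] (D : (ι →₀ M) →ₗ[R] (ι →₀ M))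
    (h1 : ∀ i m, D (Finsupp.single i m) i = m)
    (h2 : ∀ i j m, j < i → D (Finsupp.single j m) i = 0) : Function.Bijective D := by
  classical
  constructor
  · rw [← LinearMap.ker_eq_bot, LinearMap.ker_eq_bot']
    intro x hx
    by_contra hne
    have hs : x.support.Nonempty := Finsupp.support_nonempty_iff.2 hne
    set i := x.support.max' hs with hi
    have hval : D x i = x i := by
      conv_lhs => rw [← Finsupp.sum_single x, Finsupp.sum, map_sum, Finsupp.finsetSum_apply]
      rw [Finset.sum_eq_single i]
      · exact h1 _ _
      · intro j hj hji
        exact h2 _ _ _ (lt_of_le_of_ne (Finset.le_max' _ _ hj) hji)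
      · intro hni
        simp [Finsupp.notMem_support_iff.1 hni]
    rw [hx] at hval
    exact Finsupp.mem_support_iff.1 (Finset.max'_mem _ hs) (by simpa using hval.symm)
  · rw [← LinearMap.range_eq_top, eq_top_iff]
    have key : ∀ i, ∀ m, Finsupp.single i m ∈ LinearMap.range D := by
      intro i
      induction i using WellFoundedLT.induction with
      | _ i ih =>
        intro m
        -- The subtracted terms sit at indices below `i`, so the induction hypothesis covers them.
        have hd : Finsupp.single i m = D (Finsupp.single i m) -
            ∑ j ∈ (D (Finsupp.single i m)).support.erase i,
              Finsupp.single j (D (Finsupp.single i m) j) := by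
          rw [eq_sub_iff_add_eq]
          set y := D (Finsupp.single i m) with hy
          have hyi : y i = m := h1 i m
          conv_rhs => rw [← Finsupp.sum_single y, Finsupp.sum]
          by_cases hmem : i ∈ y.support
          · rw [← Finset.add_sum_erase _ _ hmem, hyi]
          · rw [Finset.erase_eq_of_notMem hmem]
            have : m = 0 := by rw [← hyi]; exact Finsupp.notMem_support_iff.1 hmem
            simp [this]
        rw [hd]
        refine Submodule.sub_mem _ (LinearMap.mem_range_self _ _) (Submodule.sum_mem _ ?_)
        intro j hj
        refine ih j ?_ _
        rw [Finset.mem_erase, Finsupp.mem_support_iff] at hj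
        by_contra hle
        exact hj.2 (h2 _ _ _ (lt_of_le_of_ne (not_lt.1 hle) (Ne.symm hj.1)))
    intro x _
    rw [← Finsupp.sum_single x]
    exact Submodule.sum_mem _ fun j _ => key j _

/-! ### Unimodular pairs and the summands they generate. -/

/-- `u` and `v` span a direct summand of rank two modulo the coordinates in `S`, as witnessed by
functionals supported on the coordinates where `u` or `v` does not vanish. -/
def IsUnimodularPair {R A ι : Type*} [CommRing R] [AddCommGroup A] [Module R A]
    (b : Module.Basis ι R A) (S : Set ι) (u v : A) : Prop :=
  ∃ l m : A →ₗ[R] R, (∀ s ∈ S, l (b s) = 0 ∧ m (b s) = 0) ∧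
    (∀ s, b.repr u s = 0 → b.repr v s = 0 → l (b s) = 0 ∧ m (b s) = 0) ∧
    l u = 1 ∧ l v = 0 ∧ m u = 0 ∧ m v = 1

theorem Module.Basis.map_eq_of_forall_repr_ne_zero {R A M ι : Type*} [CommRing R] [AddCommGroup A]
    [Module R A] [AddCommGroup M] [Module R M] (b : Module.Basis ι R A) (l l' : A →ₗ[R] M) (u : A)
    (h : ∀ i, b.repr u i ≠ 0 → l (b i) = l' (b i)) : l u = l' u := by
  rw [← b.linearCombination_repr u, Finsupp.linearCombination_apply, Finsupp.sum, map_sum, map_sum]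
  refine Finset.sum_congr rfl fun i hi => ?_
  rw [map_smul, map_smul, h i (Finsupp.mem_support_iff.1 hi)]

/-- The support condition costs nothing: killing the coordinates where both `u` and `v` vanish does
not change the four prescribed values. -/
theorem IsUnimodularPair.of_functionals {R A ι : Type*} [CommRing R] [AddCommGroup A] [Module R A]
    (b : Module.Basis ι R A) {S : Set ι} {u v : A} (l m : A →ₗ[R] R)
    (hS : ∀ s ∈ S, l (b s) = 0 ∧ m (b s) = 0)
    (h1 : l u = 1) (h2 : l v = 0) (h3 : m u = 0) (h4 : m v = 1) : IsUnimodularPair b S u v := by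
  classical
  let c : (A →ₗ[R] R) → (A →ₗ[R] R) := fun l =>
    b.constr R fun i => if b.repr u i = 0 ∧ b.repr v i = 0 then 0 else l (b i)
  have hcu : ∀ l, c l u = l u := fun l => b.map_eq_of_forall_repr_ne_zero _ _ _ fun i hi => by
    simp [c, hi]
  have hcv : ∀ l, c l v = l v := fun l => b.map_eq_of_forall_repr_ne_zero _ _ _ fun i hi => by
    simp [c, hi]
  refine ⟨c l, c m, fun s hs => ?_, fun s hu hv => ?_, ?_, ?_, ?_, ?_⟩
  · simp [c, hS s hs]
  · simp [c, hu, hv]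
  all_goals simp only [hcu, hcv]; assumption

/-- Pairs that are unimodular modulo the supports of all earlier pairs span a direct summand. -/
theorem exists_retraction_of_unimodularPairs {R A ι : Type*} [CommRing R] [AddCommGroup A]
    [Module R A] [LinearOrder ι] [WellFoundedLT ι] (b : Module.Basis ι R A) (u v : ι → A)
    (T : ι → Finset ι) (hT : ∀ i t, t ∉ T i → b.repr (u i) t = 0 ∧ b.repr (v i) t = 0)
    (h : ∀ i, IsUnimodularPair b {t | ∃ j < i, t ∈ T j} (u i) (v i)) :
    ∃ r : A →ₗ[R] A × A, (∀ x, r (b.constr R u x) = (x, 0)) ∧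
      ∀ x, r (b.constr R v x) = (0, x) := by
  classical
  choose l m hS hs h1 h2 h3 h4 using h
  have hT' : ∀ i t, t ∉ T i → l i (b t) = 0 ∧ m i (b t) = 0 := fun i t ht =>
    hs i t (hT i t ht).1 (hT i t ht).2
  have hlt : ∀ i j t, t ∈ T j → j < i → l i (b t) = 0 ∧ m i (b t) = 0 := fun i j t ht hj =>
    hS i t ⟨j, hj, ht⟩
  -- Only the first `i` with `t ∈ T i` can see `b t`: later functionals vanish on earlier supports,
  -- and each functional lives on its own support. Hence `ρ` lands in the direct sum rather than the
  -- product.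
  have hsub : ∀ t, (Function.support fun i => (l i (b t), m i (b t))).Finite := fun t => by
    refine Set.Subsingleton.finite fun i hi j hj => ?_
    have key : ∀ i, i ∈ (Function.support fun i => (l i (b t), m i (b t))) →
        t ∈ T i ∧ ∀ j < i, t ∉ T j := fun i hi => by
      constructor
      · by_contra hn
        exact hi (by simp [hT' i t hn])
      · intro j hj hn
        exact hi (by simp [hlt i j t hn hj])
    rcases lt_trichotomy i j with hij | hij | hij
    · exact absurd (key i hi).1 ((key j hj).2 i hij)
    · exact hij
    · exact absurd (key j hj).1 ((key i hi).2 j hij)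
  let ρ : A →ₗ[R] (ι →₀ R × R) := b.constr R fun t => Finsupp.ofSupportFinite _ (hsub t)
  have hρ : ∀ x i, ρ x i = (l i x, m i x) := fun x i => by
    have : Finsupp.lapply i ∘ₗ ρ = (l i).prod (m i) := b.ext fun t => by
      simp only [ρ, LinearMap.comp_apply, Module.Basis.constr_basis, Finsupp.lapply_apply,
        LinearMap.prod_apply, Function.prod_apply]
      rfl
    exact LinearMap.congr_fun this x
  let θ : (ι →₀ R × R) →ₗ[R] A := Finsupp.lsum R fun i =>
    (LinearMap.toSpanSingleton R A (u i)).coprod (LinearMap.toSpanSingleton R A (v i))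
  have hθ : ∀ i p, θ (Finsupp.single i p) = p.1 • u i + p.2 • v i := fun i p => by simp [θ]
  have hzu : ∀ i j, j < i → l i (u j) = 0 ∧ m i (u j) = 0 := fun i j hj => by
    constructor
    all_goals
      refine b.map_eq_of_forall_repr_ne_zero _ 0 _ fun t ht => ?_
      have : t ∈ T j := by
        by_contra hn
        exact ht (hT j t hn).1
      simp [hlt i j t this hj]
  have hzv : ∀ i j, j < i → l i (v j) = 0 ∧ m i (v j) = 0 := fun i j hj => by
    constructor
    all_goals
      refine b.map_eq_of_forall_repr_ne_zero _ 0 _ fun t ht => ?_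
      have : t ∈ T j := by
        by_contra hn
        exact ht (hT j t hn).2
      simp [hlt i j t this hj]
  -- The functionals of a pair kill all earlier pairs, so `ρ ∘ θ` is unitriangular, and `(ρ ∘ θ)⁻¹ ∘
  -- ρ` retracts `θ`.
  have hbij : Function.Bijective (ρ ∘ₗ θ) := by
    refine bijective_of_unitriangular _ (fun i p => ?_) (fun i j p hj => ?_)
    · rw [LinearMap.comp_apply, hρ, hθ]
      simp [h1, h2, h3, h4]
    · rw [LinearMap.comp_apply, hρ, hθ]
      simp [hzu i j hj, hzv i j hj]
  let e := LinearEquiv.ofBijective _ hbij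
  let r : A →ₗ[R] (ι →₀ R × R) := e.symm.toLinearMap ∘ₗ ρ
  have hr : ∀ x, r (θ x) = x := fun x => e.symm_apply_apply x
  let r' : A →ₗ[R] A × A := LinearMap.prod
    (b.repr.symm.toLinearMap ∘ₗ Finsupp.mapRange.linearMap (LinearMap.fst R R R) ∘ₗ r)
    (b.repr.symm.toLinearMap ∘ₗ Finsupp.mapRange.linearMap (LinearMap.snd R R R) ∘ₗ r)
  refine ⟨r', ?_, ?_⟩
  · refine LinearMap.congr_fun (f := r' ∘ₗ b.constr R u) (g := LinearMap.inl R A A) (b.ext fun i => ?_)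
    have : u i = θ (Finsupp.single i (1, 0)) := by simp [hθ]
    simp [r', this, hr]
  · refine LinearMap.congr_fun (f := r' ∘ₗ b.constr R v) (g := LinearMap.inr R A A) (b.ext fun i => ?_)
    have : v i = θ (Finsupp.single i (0, 1)) := by simp [hθ]
    simp [r', this, hr]

/-! ### The dichotomy: scalar modulo a prime, or moving a summand. -/

/-- `φ` maps the image of some split embedding `a : A → A` to an independent direct summand: the
two images together form a direct summand. -/
def MovesSummand {R A : Type*} [CommRing R] [AddCommGroup A] [Module R A] (φ : A ≃ₗ[R] A) : Prop :=
  ∃ (a : A →ₗ[R] A) (r : A →ₗ[R] A × A), (∀ x, r (a x) = (x, 0)) ∧ ∀ x, r (φ (a x)) = (0, x)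

/-- The coordinates in `S`, as a homomorphism to a free module of rank `#S`. -/
noncomputable def Module.Basis.restrictCoords {R A ι : Type*} [CommRing R] [AddCommGroup A]
    [Module R A] (b : Module.Basis ι R A) (S : Set ι) : A →ₗ[R] (S →₀ R) :=
  Finsupp.lsubtypeDomain S ∘ₗ b.repr.toLinearMap

theorem Module.Basis.restrictCoords_eq_zero {R A ι : Type*} [CommRing R] [AddCommGroup A]
    [Module R A] (b : Module.Basis ι R A) {S : Set ι} {x : A} :
    b.restrictCoords S x = 0 ↔ ∀ s ∈ S, b.repr x s = 0 := by
  rw [Finsupp.ext_iff]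
  exact Subtype.forall

theorem lift_rank_coords_lt {R : Type v} {A ι : Type u} [CommRing R] [IsDomain R]
    [AddCommGroup A] [Module R A] [Infinite ι] (b : Module.Basis ι R A) (S T : Set ι)
    (hS : Cardinal.mk S < Cardinal.mk ι) (hT : Cardinal.mk T < Cardinal.mk ι) :
    Cardinal.lift.{u} (Module.rank R ((S →₀ R) × (T →₀ R))) <
      Cardinal.lift.{max u v} (Module.rank R A) := by
  have h2 := Cardinal.lift_lt.{u, max u v}.2
    (Cardinal.add_lt_of_lt (Cardinal.aleph0_le_mk ι) hS hT)
  rw [← b.mk_eq_rank'']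
  simpa using h2

/-- The prescribed conditions say that `w` lies in the kernel of a map to a free module of smaller
rank, and such a kernel contains a unimodular vector. -/
theorem exists_unimodular_of_small {R : Type v} {A ι : Type u} [CommRing R] [IsDomain R]
    [IsPrincipalIdealRing R] [AddCommGroup A] [Module R A] [Infinite ι] (b : Module.Basis ι R A)
    (φ : A →ₗ[R] A) (S T : Set ι)
    (hS : Cardinal.mk S < Cardinal.mk ι) (hT : Cardinal.mk T < Cardinal.mk ι) :
    ∃ w, (∀ s ∈ S, b.repr w s = 0) ∧ (∀ t ∈ T, b.repr (φ w) t = 0) ∧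
      ∃ l : A →ₗ[R] R, l w = 1 := by
  have := Module.Free.of_basis b
  obtain ⟨w, hw, hl⟩ := exists_unimodular_mem_ker
    ((b.restrictCoords S).prod (b.restrictCoords T ∘ₗ φ)) (lift_rank_coords_lt b S T hS hT)
  rw [LinearMap.prod_apply, Function.prod_apply, Prod.mk_eq_zero, LinearMap.comp_apply,
    b.restrictCoords_eq_zero, b.restrictCoords_eq_zero] at hw
  exact ⟨w, hw.1, hw.2, hl⟩

/-- `φ` agrees with a scalar modulo `p` on a large direct summand. -/
def IsScalarModOnLarge {R A : Type*} [CommRing R] [AddCommGroup A] [Module R A]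
    (p : R) (φ : A ≃ₗ[R] A) : Prop :=
  ∃ (k : R) (L : Submodule R A), (∃ V, IsCompl L V) ∧
    Module.rank R (A ⧸ L) < Module.rank R A ∧ ∀ x ∈ L, ∃ y : A, φ x = k • x + p • y

theorem Module.Basis.exists_eq_smul {R A ι : Type*} [CommRing R] [AddCommGroup A]
    [Module R A] (b : Module.Basis ι R A) {p : R} {x : A} (h : ∀ i, p ∣ b.repr x i) :
    ∃ y, x = p • y := by
  choose c hc using h
  refine ⟨∑ i ∈ (b.repr x).support, c i • b i, ?_⟩
  conv_lhs => rw [← b.linearCombination_repr x, Finsupp.linearCombination_apply, Finsupp.sum]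
  rw [Finset.smul_sum]
  exact Finset.sum_congr rfl fun i _ => by rw [hc, mul_smul]

theorem Module.Basis.exists_repr_notMem {R A ι : Type*} [CommRing R] [AddCommGroup A]
    [Module R A] (b : Module.Basis ι R A) {P : Ideal R} (hP : P ≠ ⊤) {w : A} (l : A →ₗ[R] R)
    (hl : l w = 1) : ∃ i, b.repr w i ∉ P := by
  by_contra! h
  apply hP
  rw [Ideal.eq_top_iff_one, ← hl, ← b.linearCombination_repr w, Finsupp.linearCombination_apply,
    Finsupp.sum, map_sum]
  refine Ideal.sum_mem _ fun i _ => ?_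
  rw [map_smul, smul_eq_mul]
  exact P.mul_mem_right _ (h i)

/-- If all minors of `(w, φ w)` vanish modulo `p` for `w` in the large summand `M`, then `φ w` is
residually proportional to `w` wherever `w` is nonzero modulo `p`. Polarizing the quadratic identity
forces a single factor on all of `M`, so `φ` would be scalar there. -/
theorem exists_minor_notMem {R : Type v} {A ι : Type u} [CommRing R] [IsDomain R]
    [IsPrincipalIdealRing R] [AddCommGroup A] [Module R A] [Infinite ι] (b : Module.Basis ι R A)
    (φ : A ≃ₗ[R] A) (p : R) (hp : (Ideal.span {p}).IsMaximal) (hφ : ¬ IsScalarModOnLarge p φ)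
    (S : Set ι) (hS : Cardinal.mk S < Cardinal.mk ι) :
    ∃ w, (∀ s ∈ S, b.repr w s = 0 ∧ b.repr (φ w) s = 0) ∧ ∃ i j,
      b.repr w i * b.repr (φ w) j - b.repr w j * b.repr (φ w) i ∉ Ideal.span {p} := by
  by_contra! hcon
  apply hφ
  let q := Ideal.Quotient.mk (Ideal.span {p})
  let _ : Field (R ⧸ Ideal.span {p}) := Ideal.Quotient.field _
  have hq : ∀ a, q a = 0 ↔ a ∈ Ideal.span {p} := fun a => Ideal.Quotient.eq_zero_iff_mem
  let X : A → ι → R ⧸ Ideal.span {p} := fun x i => q (b.repr x i)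
  let Y : A → ι → R ⧸ Ideal.span {p} := fun x i => q (b.repr (φ x) i)
  let M : Submodule R A := LinearMap.ker
    ((b.restrictCoords S).prod (b.restrictCoords S ∘ₗ φ.toLinearMap))
  have hM : ∀ x, x ∈ M ↔ ∀ s ∈ S, b.repr x s = 0 ∧ b.repr (φ x) s = 0 := fun x => by
    simp only [M, LinearMap.mem_ker]
    rw [LinearMap.prod_apply, Function.prod_apply, Prod.mk_eq_zero, LinearMap.comp_apply,
      b.restrictCoords_eq_zero, b.restrictCoords_eq_zero]
    exact ⟨fun h s hs => ⟨h.1 s hs, h.2 s hs⟩,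
      fun h => ⟨fun s hs => (h s hs).1, fun s hs => (h s hs).2⟩⟩
  have H : ∀ x ∈ M, ∀ i j, X x i * Y x j = X x j * Y x i := fun x hx i j => by
    have := (hq _).2 (hcon x ((hM x).1 hx) i j)
    rw [map_sub, map_mul, map_mul, sub_eq_zero] at this
    exact this
  have Xadd : ∀ x y i, X (x + y) i = X x i + X y i := fun x y i => by simp [X]
  have Yadd : ∀ x y i, Y (x + y) i = Y x i + Y y i := fun x y i => by simp [Y]
  have Pol : ∀ x ∈ M, ∀ y ∈ M, ∀ i j,
      X x i * Y y j + X y i * Y x j = X x j * Y y i + X y j * Y x i := fun x hx y hy i j => by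
    have h := H _ (M.add_mem hx hy) i j
    rw [Xadd, Xadd, Yadd, Yadd] at h
    linear_combination h - H x hx i j - H y hy i j
  obtain ⟨x₁, h1S, h1T, l₁, hl₁⟩ := exists_unimodular_of_small b φ.toLinearMap S S hS hS
  have h1M : x₁ ∈ M := (hM _).2 fun s hs => ⟨h1S s hs, h1T s hs⟩
  obtain ⟨i, hi⟩ := b.exists_repr_notMem hp.ne_top l₁ hl₁
  have hXi : X x₁ i ≠ 0 := fun h => hi ((hq _).1 h)
  have hSi : Cardinal.mk (insert i S : Set ι) < Cardinal.mk ι :=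
    lt_of_le_of_lt (Cardinal.mk_insert_le) (Cardinal.add_lt_of_lt (Cardinal.aleph0_le_mk ι) hS
      (lt_of_lt_of_le Cardinal.one_lt_aleph0 (Cardinal.aleph0_le_mk ι)))
  -- The vector `x₁` alone only shows that `Y x - k X x` is a multiple of `X x₁` (this is `star`). A
  -- second vector with zero coordinate at `i`, residually independent of `x₁`, removes this
  -- rank-one error.
  obtain ⟨x₂, h2S, h2T, l₂, hl₂⟩ := exists_unimodular_of_small b φ.toLinearMap (insert i S) S hSi hS
  have h2M : x₂ ∈ M := (hM _).2 fun s hs => ⟨h2S s (Or.inr hs), h2T s hs⟩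
  have hX2i : X x₂ i = 0 := by
    change q _ = 0
    rw [h2S i (Or.inl rfl), map_zero]
  obtain ⟨j, hj⟩ := b.exists_repr_notMem hp.ne_top l₂ hl₂
  have hXj : X x₂ j ≠ 0 := fun h => hj ((hq _).1 h)
  obtain ⟨k, hk⟩ := Ideal.Quotient.mk_surjective (Y x₁ i / X x₁ i)
  have hk1 : Y x₁ i = q k * X x₁ i := by
    change q k = _ at hk
    rw [hk, div_mul_cancel₀ _ hXi]
  have hY1 : ∀ c, Y x₁ c = q k * X x₁ c := fun c => by
    apply mul_left_cancel₀ hXi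
    linear_combination H x₁ h1M i c + X x₁ c * hk1
  have star : ∀ x ∈ M, ∀ c, X x₁ i * (Y x c - q k * X x c) = X x₁ c * (Y x i - q k * X x i) :=
    fun x hx c => by
      linear_combination Pol x₁ h1M x hx i c - X x i * hY1 c + X x c * hY1 i
  have hY2i : Y x₂ i = 0 := by
    have h := H x₂ h2M i j
    rw [hX2i, zero_mul] at h
    exact (mul_eq_zero.1 h.symm).resolve_left hXj
  have hY2 : ∀ c, Y x₂ c = q k * X x₂ c := fun c => by
    apply mul_left_cancel₀ hXi
    linear_combination star x₂ h2M c + X x₁ c * hY2i - X x₁ c * q k * hX2i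
  have hYi : ∀ x ∈ M, Y x i = q k * X x i := fun x hx => by
    apply mul_left_cancel₀ hXj
    linear_combination Pol x₂ h2M x hx j i - X x j * hY2i + Y x j * hX2i + X x i * hY2 j
  have hY : ∀ x ∈ M, ∀ c, Y x c = q k * X x c := fun x hx c => by
    apply mul_left_cancel₀ hXi
    linear_combination star x hx c + X x₁ c * hYi x hx
  refine ⟨k, M, ?_, ?_, fun x hx => ?_⟩
  · obtain ⟨π, hπ⟩ := exists_projection_ker
      ((b.restrictCoords S).prod (b.restrictCoords S ∘ₗ φ.toLinearMap))
    exact ⟨_, LinearMap.isCompl_of_proj hπ⟩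
  · have h := lt_of_le_of_lt (lift_rank_quotient_ker_le
      ((b.restrictCoords S).prod (b.restrictCoords S ∘ₗ φ.toLinearMap)))
      (lift_rank_coords_lt b S S hS hS)
    exact Cardinal.lift_lt.1 h
  · obtain ⟨y, hy⟩ := b.exists_eq_smul (p := p) (x := φ x - k • x) fun c => by
      rw [← Ideal.mem_span_singleton, ← hq]
      have h := hY x hx c
      simp only [X, Y] at h
      simp [h]
    exact ⟨y, by rw [← hy]; abel⟩

/-- Take `w` with maximal ideal of minors outside `S`, which exists because `R` is Noetherian. If
that ideal lay in a maximal `(p)`, adding an `x` whose coordinates and whose image's coordinates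
vanish on the supports of `w` and `φ w` would keep the old minors and add one outside `(p)`. -/
theorem exists_unimodularPair {R : Type v} {A ι : Type u} [CommRing R] [IsDomain R]
    [IsPrincipalIdealRing R] [AddCommGroup A] [Module R A] [Infinite ι] (b : Module.Basis ι R A)
    (φ : A ≃ₗ[R] A)
    (hφ : ∀ p : R, (Ideal.span {p}).IsMaximal → ¬ IsScalarModOnLarge p φ)
    (S : Set ι) (hS : Cardinal.mk S < Cardinal.mk ι) :
    ∃ w, IsUnimodularPair b S w (φ w) := by
  classical
  let d : A → ι → ι → R := fun w i j =>
    b.repr w i * b.repr (φ w) j - b.repr w j * b.repr (φ w) i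
  let I : A → Ideal R := fun w => Ideal.span {c | ∃ i ∉ S, ∃ j ∉ S, c = d w i j}
  obtain ⟨_, ⟨w, rfl⟩, hmax⟩ := WellFounded.has_min (wellFounded_gt (α := Ideal R))
    (Set.range I) (Set.range_nonempty _)
  have htop : I w = ⊤ := by
    by_contra hne
    obtain ⟨P, hP, hle⟩ := Ideal.exists_le_maximal _ hne
    obtain ⟨p, rfl⟩ : ∃ p, P = Ideal.span {p} :=
      ⟨_, (Ideal.span_singleton_generator P).symm⟩
    let T : Finset ι := (b.repr w).support ∪ (b.repr (φ w)).support
    have hT : ∀ t ∉ T, b.repr w t = 0 ∧ b.repr (φ w) t = 0 := fun t ht => by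
      simpa [T] using ht
    have hST : Cardinal.mk (S ∪ T : Set ι) < Cardinal.mk ι :=
      lt_of_le_of_lt (Cardinal.mk_union_le _ _) (Cardinal.add_lt_of_lt (Cardinal.aleph0_le_mk ι) hS
        (lt_of_lt_of_le (Finset.finite_toSet T).lt_aleph0 (Cardinal.aleph0_le_mk ι)))
    obtain ⟨x, hx, i, j, hij⟩ := exists_minor_notMem b φ p hP (hφ p hP) _ hST
    have hxT : ∀ t ∈ T, b.repr x t = 0 ∧ b.repr (φ x) t = 0 := fun t ht => hx t (Or.inr ht)
    have hxS : ∀ t ∈ S, b.repr x t = 0 ∧ b.repr (φ x) t = 0 := fun t ht => hx t (Or.inl ht)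
    have hsum : ∀ i j, d (w + x) i j = (if i ∈ T ∧ j ∈ T then d w i j else d (w + x) i j) ∧
        (i ∉ T → j ∉ T → d (w + x) i j = d x i j) := fun i j => by
      constructor
      · split_ifs with h
        · simp [d, hxT i h.1, hxT j h.2]
        · rfl
      · intro h1 h2
        simp [d, hT i h1, hT j h2]
    have hle' : I w ≤ I (w + x) := by
      refine Ideal.span_le.2 ?_
      rintro _ ⟨i, hi, j, hj, rfl⟩
      by_cases h : i ∈ T ∧ j ∈ T
      · refine Ideal.subset_span ⟨i, hi, j, hj, ?_⟩
        rw [(hsum i j).1, if_pos h]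
      · have : d w i j = 0 := by
          rcases not_and_or.1 h with h | h
          · simp [d, hT i h]
          · simp [d, hT j h]
        rw [this]
        exact Ideal.zero_mem _
    have hmem : d x i j ∈ I (w + x) := by
      have hn : ∀ t, t ∈ S ∨ t ∈ T → b.repr x t = 0 ∧ b.repr (φ x) t = 0 := fun t ht => hx t ht
      by_cases hi : i ∈ S ∨ i ∈ T
      · have : d x i j = 0 := by simp [d, hn i hi]
        rw [this]; exact Ideal.zero_mem _
      by_cases hj : j ∈ S ∨ j ∈ T
      · have : d x i j = 0 := by simp [d, hn j hj]
        rw [this]; exact Ideal.zero_mem _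
      push Not at hi hj
      exact Ideal.subset_span ⟨i, hi.1, j, hj.1, ((hsum i j).2 hi.2 hj.2).symm⟩
    exact hmax _ ⟨_, rfl⟩ (lt_of_le_of_ne hle' fun h => hij (hle (h ▸ hmem)))
  -- The scalars `z` for which some pair of functionals killing `S` takes the matrix `z` times the
  -- identity on `(w, φ w)`. They form an ideal, and it contains every minor by Cramer's rule.
  let J : Submodule R R :=
    { carrier := {z | ∃ l m : A →ₗ[R] R, (∀ s ∈ S, l (b s) = 0 ∧ m (b s) = 0) ∧
        l w = z ∧ l (φ w) = 0 ∧ m w = 0 ∧ m (φ w) = z}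
      zero_mem' := ⟨0, 0, by simp⟩
      add_mem' := by
        rintro _ _ ⟨l, m, h, rfl, h2, h3, h4⟩ ⟨l', m', h', rfl, h2', h3', h4'⟩
        refine ⟨l + l', m + m', fun s hs => ?_, ?_⟩
        · simp [h s hs, h' s hs]
        · simp [h2, h3, h4, h2', h3', h4']
      smul_mem' := by
        rintro c _ ⟨l, m, h, rfl, h2, h3, h4⟩
        refine ⟨c • l, c • m, fun s hs => ?_, ?_⟩
        · simp [h s hs]
        · simp [h2, h3, h4] }
  have hJ : I w ≤ J := by
    refine Ideal.span_le.2 ?_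
    rintro _ ⟨i, hi, j, hj, rfl⟩
    refine ⟨b.repr (φ w) j • b.coord i - b.repr (φ w) i • b.coord j,
      b.repr w i • b.coord j - b.repr w j • b.coord i, fun s hs => ?_, ?_, ?_, ?_, ?_⟩
    · have h1 : s ≠ i := fun h => hi (h ▸ hs)
      have h2 : s ≠ j := fun h => hj (h ▸ hs)
      simp [h1, h2]
    all_goals
      simp only [d, LinearMap.sub_apply, LinearMap.smul_apply, Module.Basis.coord_apply,
        smul_eq_mul] <;> ring
  obtain ⟨l, m, h, h1, h2, h3, h4⟩ : (1 : R) ∈ J := hJ (by rw [htop]; trivial)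
  exact ⟨w, .of_functionals b l m h h1 h2 h3 h4⟩

/-- An automorphism that agrees with no scalar on a large summand modulo a maximal ideal moves a
moietous summand to an independent one. -/
theorem movesSummand_of_not_isScalarModOnLarge {R : Type v} {A ι : Type u} [CommRing R]
    [IsDomain R] [IsPrincipalIdealRing R] [AddCommGroup A] [Module R A] [Infinite ι]
    (b : Module.Basis ι R A) (φ : A ≃ₗ[R] A)
    (hφ : ∀ p : R, (Ideal.span {p}).IsMaximal → ¬ IsScalarModOnLarge p φ) : MovesSummand φ := by
  classical
  obtain ⟨_, _, x, hx⟩ := exists_wellOrder_family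
    (P := fun S w => IsUnimodularPair b S w (φ w))
    (fun w => (b.repr w).support ∪ (b.repr (φ w)).support) (exists_unimodularPair b φ hφ)
  obtain ⟨r, hr1, hr2⟩ := exists_retraction_of_unimodularPairs b x (fun i => φ (x i)) _
    (fun i t ht => by simpa using ht) hx
  refine ⟨b.constr R x, r, hr1, fun y => ?_⟩
  rw [← hr2 y]
  congr 1
  exact LinearMap.congr_fun (f := φ.toLinearMap ∘ₗ b.constr R x) (b.ext fun i => by simp) y

/-! ### Factoring an automorphism into two moving ones. -/

theorem IsUnimodularPair.of_basis {R A ι : Type*} [CommRing R] [AddCommGroup A] [Module R A]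
    (b : Module.Basis ι R A) {S : Set ι} {w : A} (hw : ∀ s ∈ S, b.repr w s = 0)
    (l : A →ₗ[R] R) (hl : l w = 1) {i : ι} (hi : i ∉ S) (hwi : b.repr w i = 0) :
    IsUnimodularPair b S w (b i) := by
  classical
  refine .of_functionals b (b.constr R fun s => if s ∈ S ∨ s = i then 0 else l (b s)) (b.coord i)
    (fun s hs => ?_) ?_ ?_ ?_ ?_
  · have : s ≠ i := fun h => hi (h ▸ hs)
    simp [hs, this]
  · rw [← hl]
    refine b.map_eq_of_forall_repr_ne_zero _ _ _ fun s hs => ?_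
    have h1 : s ∉ S := fun h => hs (hw s h)
    have h2 : s ≠ i := fun h => hs (h ▸ hwi)
    simp [h1, h2]
  · simp
  · simpa using hwi
  · simp

/-- Two independent copies of `A` in `A` are exchanged by an involution. -/
theorem exists_automorphism_swap {R A : Type*} [CommRing R] [AddCommGroup A] [Module R A]
    (a c : A →ₗ[R] A) (r : A →ₗ[R] A × A) (ha : ∀ x, r (a x) = (x, 0))
    (hc : ∀ x, r (c x) = (0, x)) :
    ∃ n : A ≃ₗ[R] A, (∀ x, n (a x) = c x) ∧ ∀ x, n⁻¹ (c x) = a x := by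
  let f : A →ₗ[R] A := LinearMap.id + (c - a) ∘ₗ LinearMap.fst R A A ∘ₗ r +
    (a - c) ∘ₗ LinearMap.snd R A A ∘ₗ r
  have hf : ∀ x, f x = x + (c (r x).1 - a (r x).1) + (a (r x).2 - c (r x).2) := fun x => rfl
  have hrf : ∀ x, r (f x) = ((r x).2, (r x).1) := fun x => by
    rw [hf, map_add, map_add, map_sub, map_sub, ha, ha, hc, hc]
    ext <;> simp
  have hinv : Function.Involutive f := fun x => by
    rw [hf (f x), hrf, hf x]
    abel
  have hfa : ∀ x, f (a x) = c x := fun x => by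
    rw [hf, ha]; simp
  refine ⟨LinearEquiv.ofInvolutive f hinv, hfa, fun x => ?_⟩
  change (LinearEquiv.ofInvolutive f hinv).symm (c x) = a x
  rw [LinearEquiv.symm_apply_eq]
  exact (hfa x).symm

/-- Every automorphism is a product of two that move a moietous summand to an independent one. -/
theorem exists_mul_eq_movesSummand {R : Type v} {A ι : Type u} [CommRing R]
    [IsDomain R] [IsPrincipalIdealRing R] [AddCommGroup A] [Module R A] [Infinite ι]
    (b : Module.Basis ι R A) (ψ : A ≃ₗ[R] A) :
    ∃ g n : A ≃ₗ[R] A, ψ = g * n ∧ MovesSummand g ∧ MovesSummand n := by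
  classical
  obtain ⟨_, _, x, hx⟩ := exists_wellOrder_family
    (P := fun S (q : A × A) => IsUnimodularPair b S q.1 q.2 ∧ IsUnimodularPair b S (ψ q.1) q.2)
    (fun q => (b.repr q.1).support ∪ (b.repr (ψ q.1)).support ∪ (b.repr q.2).support) (by
      intro S hS
      obtain ⟨w, hwS, hψ, l, hl⟩ := exists_unimodular_of_small b ψ.toLinearMap S S hS hS
      let T : Finset ι := (b.repr w).support ∪ (b.repr (ψ w)).support
      have hST : Cardinal.mk (S ∪ T : Set ι) < Cardinal.mk ι :=
        lt_of_le_of_lt (Cardinal.mk_union_le _ _)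
          (Cardinal.add_lt_of_lt (Cardinal.aleph0_le_mk ι) hS
            (lt_of_lt_of_le (Finset.finite_toSet T).lt_aleph0 (Cardinal.aleph0_le_mk ι)))
      -- A basis vector outside `S` and both supports is a common partner for `w` and `ψ w`.
      obtain ⟨i, hi⟩ : ∃ i, i ∉ (S ∪ T : Set ι) := by
        by_contra! h
        rw [Set.eq_univ_of_forall h, Cardinal.mk_univ] at hST
        exact lt_irrefl _ hST
      have hiS : i ∉ S := fun h => hi (Or.inl h)
      have hiT : b.repr w i = 0 ∧ b.repr (ψ w) i = 0 := by
        have : i ∉ T := fun h => hi (Or.inr h)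
        simpa [T] using this
      exact ⟨(w, b i), .of_basis b hwS l hl hiS hiT.1,
        .of_basis b hψ (l ∘ₗ ψ.symm.toLinearMap) (by simpa using hl) hiS hiT.2⟩)
  obtain ⟨r, hr1, hr2⟩ := exists_retraction_of_unimodularPairs b (fun i => (x i).1)
    (fun i => (x i).2) _ (fun i t ht => by
      simp only [Finset.mem_union, Finsupp.mem_support_iff, not_or, not_not] at ht
      exact ⟨ht.1.1, ht.2⟩) (fun i => (hx i).1)
  obtain ⟨r', hr1', hr2'⟩ := exists_retraction_of_unimodularPairs b (fun i => ψ (x i).1)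
    (fun i => (x i).2) _ (fun i t ht => by
      simp only [Finset.mem_union, Finsupp.mem_support_iff, not_or, not_not] at ht
      exact ⟨ht.1.2, ht.2⟩) (fun i => (hx i).2)
  obtain ⟨n, hn, hn'⟩ := exists_automorphism_swap _ _ r hr1 hr2
  -- The involution `n` exchanges the vectors `(x i).1` with their partners, so `ψ * n⁻¹` sends each
  -- partner `(x i).2` to `ψ (x i).1`. Since `r'` lists the images under `ψ` first, its components
  -- are exchanged.
  refine ⟨ψ * n⁻¹, n, by simp, ⟨b.constr R fun i => (x i).2,
    (LinearMap.snd R A A).prod (LinearMap.fst R A A) ∘ₗ r', fun y => ?_, fun y => ?_⟩,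
    ⟨_, r, hr1, fun y => by rw [hn, hr2]⟩⟩
  · simp [hr2']
  · rw [LinearEquiv.mul_apply, hn']
    have h : ψ (b.constr R (fun i => (x i).1) y) = b.constr R (fun i => ψ (x i).1) y :=
      LinearMap.congr_fun (f := ψ.toLinearMap ∘ₗ b.constr R fun i => (x i).1)
        (b.ext fun i => by simp) y
    rw [h]
    simp [hr1']

/-! ### Normal subgroups that induce every automorphism of a block. -/

section Blocks

variable {R : Type*} [CommRing R] {F D : Type*} [AddCommGroup F] [Module R F]
  [AddCommGroup D] [Module R D]

/-- The automorphism `(x, d) ↦ (x + ε d, d)`. -/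
def transvectionEquiv (ε : D →ₗ[R] F) : (F × D) ≃ₗ[R] F × D where
  toFun p := (p.1 + ε p.2, p.2)
  invFun p := (p.1 - ε p.2, p.2)
  map_add' p q := by ext <;> simp; abel
  map_smul' c p := by ext <;> simp
  left_inv p := by simp
  right_inv p := by simp

theorem transvectionEquiv_apply (ε : D →ₗ[R] F) (p : F × D) :
    transvectionEquiv ε p = (p.1 + ε p.2, p.2) := rfl

/-- The automorphism group of a module of the form `Q × Q` contains a commutator `u` for which
`u - 1` is surjective. -/
theorem exists_commutator_sub_one_surjective {Q : Type*} [AddCommGroup Q] [Module R Q]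
    (e : F ≃ₗ[R] Q × Q) : ∃ (t k : F ≃ₗ[R] F) (v : F →ₗ[R] F),
      ∀ y, (t⁻¹ * k * t * k⁻¹) (v y) - v y = y := by
  let T : (Q × Q) ≃ₗ[R] Q × Q :=
    { toFun := fun p => (p.1 + p.2, p.2)
      invFun := fun p => (p.1 - p.2, p.2)
      map_add' := fun p q => by ext <;> simp; abel
      map_smul' := fun c p => by ext <;> simp
      left_inv := fun p => by simp
      right_inv := fun p => by simp }
  let K : (Q × Q) ≃ₗ[R] Q × Q :=
    { toFun := fun p => (p.1, p.1 + p.2)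
      invFun := fun p => (p.1, p.2 - p.1)
      map_add' := fun p q => by ext <;> simp; abel
      map_smul' := fun c p => by ext <;> simp
      left_inv := fun p => by simp
      right_inv := fun p => by simp }
  -- The commutator `T⁻¹ K T K⁻¹` has matrix `(1, -1; -1, 2)`. Subtracting the identity leaves
  -- determinant `-1`, and `V` is the inverse of the difference.
  let V : (Q × Q) →ₗ[R] Q × Q :=
    { toFun := fun p => (-p.1 - p.2, -p.1)
      map_add' := fun p q => by ext <;> simp <;> abel
      map_smul' := fun c p => by ext <;> simp [smul_sub] }
  let t : F ≃ₗ[R] F := e.trans (T.trans e.symm)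
  let k : F ≃ₗ[R] F := e.trans (K.trans e.symm)
  have ht : ∀ p, t (e.symm p) = e.symm (T p) := fun p => by simp [t]
  have ht' : ∀ p, t⁻¹ (e.symm p) = e.symm (T.symm p) := fun p => by
    change t.symm _ = _
    simp [t]
  have hk : ∀ p, k (e.symm p) = e.symm (K p) := fun p => by simp [k]
  have hk' : ∀ p, k⁻¹ (e.symm p) = e.symm (K.symm p) := fun p => by
    change k.symm _ = _
    simp [k]
  refine ⟨t, k, e.symm.toLinearMap ∘ₗ V ∘ₗ e.toLinearMap, fun y => ?_⟩
  change t⁻¹ (k (t (k⁻¹ (e.symm (V (e y)))))) - e.symm (V (e y)) = y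
  rw [hk', ht, hk, ht', ← map_sub, LinearEquiv.symm_apply_eq]
  generalize e y = p
  have hT : ∀ p, T p = (p.1 + p.2, p.2) := fun _ => rfl
  have hT' : ∀ p, T.symm p = (p.1 - p.2, p.2) := fun _ => rfl
  have hK : ∀ p, K p = (p.1, p.1 + p.2) := fun _ => rfl
  have hK' : ∀ p, K.symm p = (p.1, p.2 - p.1) := fun _ => rfl
  have hV : ∀ p, V p = (-p.1 - p.2, -p.1) := fun _ => rfl
  rw [hV, hK', hT, hK, hT']
  refine Prod.ext ?_ ?_
  all_goals
    simp only [Prod.fst_sub, Prod.snd_sub]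
    abel

variable (N : Subgroup ((F × D) ≃ₗ[R] F × D)) [hN : N.Normal]
  (hF : ∀ t : F ≃ₗ[R] F, ∃ h ∈ N, ∀ x, h (x, 0) = (t x, 0))

include hF hN

/-- With `h ∈ N` restricting to `t` and `K = k ⊕ 1`, the element is `h⁻¹ K h K⁻¹`. It is trivial
modulo `F` because `K` changes vectors only in the direction of `F`, which `h⁻¹` preserves. -/
theorem exists_mem_normal_block (t k : F ≃ₗ[R] F) : ∃ c ∈ N,
    (∀ x, c (x, 0) = ((t⁻¹ * k * t * k⁻¹) x, 0)) ∧ ∀ p, (c p).2 = p.2 := by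
  obtain ⟨h, hh, ht⟩ := hF t
  let K : (F × D) ≃ₗ[R] F × D := LinearEquiv.prodCongr k (LinearEquiv.refl R D)
  have hK : ∀ p, K p = (k p.1, p.2) := fun p => rfl
  have hK' : ∀ p, K⁻¹ p = (k⁻¹ p.1, p.2) := fun p => rfl
  have hi : ∀ x, h⁻¹ (x, 0) = (t⁻¹ x, 0) := fun x => by
    change h.symm (x, 0) = _
    rw [LinearEquiv.symm_apply_eq, ht]
    exact Prod.ext (t.apply_symm_apply x).symm rfl
  refine ⟨h⁻¹ * (K * h * K⁻¹), N.mul_mem (N.inv_mem hh) (hN.conj_mem _ hh _), fun x => ?_,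
    fun p => ?_⟩
  · change h⁻¹ (K (h (K⁻¹ (x, 0)))) = _
    rw [hK', ht, hK, hi]
    rfl
  · change (h⁻¹ (K (h (K⁻¹ p)))).2 = _
    have : K (h (K⁻¹ p)) = h (K⁻¹ p) + (k (h (K⁻¹ p)).1 - (h (K⁻¹ p)).1, 0) := by
      rw [hK]; ext <;> simp
    rw [this, map_add, hi]
    have h2 : h⁻¹ (h (K⁻¹ p)) = K⁻¹ p := h.symm_apply_apply _
    rw [h2, hK']
    simp

/-- If `c` acts as `u` on `F` and trivially modulo `F`, conjugation by `c` turns the transvection of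
`δ` into that of `u ∘ δ`. The commutator is the transvection of `(u - 1) ∘ δ`, and every `ε` has
this form when `u - 1` has a right inverse. -/
theorem transvectionEquiv_mem_normal {Q : Type*} [AddCommGroup Q] [Module R Q]
    (e : F ≃ₗ[R] Q × Q) (ε : D →ₗ[R] F) : transvectionEquiv ε ∈ N := by
  obtain ⟨t, k, v, hv⟩ := exists_commutator_sub_one_surjective e
  obtain ⟨c, hc, h1, h2⟩ := exists_mem_normal_block N hF t k
  have key : transvectionEquiv ε =
      c * (transvectionEquiv (v ∘ₗ ε) * c⁻¹ * (transvectionEquiv (v ∘ₗ ε))⁻¹) := by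
    rw [← mul_assoc, ← mul_assoc, eq_mul_inv_iff_mul_eq, eq_mul_inv_iff_mul_eq]
    ext1 p
    change transvectionEquiv ε (transvectionEquiv (v ∘ₗ ε) (c p)) =
      c (transvectionEquiv (v ∘ₗ ε) p)
    have h3 : transvectionEquiv (v ∘ₗ ε) p = p + (v (ε p.2), 0) := by
      rw [transvectionEquiv_apply]; ext <;> simp
    rw [h3, map_add, h1]
    simp only [transvectionEquiv_apply, h2, LinearMap.comp_apply]
    ext
    · have := hv (ε p.2)
      simp only [Prod.fst_add]
      rw [sub_eq_iff_eq_add] at this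
      rw [this]; abel
    · simp [h2]
  rw [key]
  exact N.mul_mem hc (hN.conj_mem _ (N.inv_mem hc) _)

/-- The element from `exists_mem_normal_block` differs from this block diagonal map by a
transvection, which is already in `N`. -/
theorem prodCongr_commutator_mem_normal {Q : Type*} [AddCommGroup Q] [Module R Q]
    (e : F ≃ₗ[R] Q × Q) (t k : F ≃ₗ[R] F) :
    LinearEquiv.prodCongr (t⁻¹ * k * t * k⁻¹) (LinearEquiv.refl R D) ∈ N := by
  obtain ⟨c, hc, h1, h2⟩ := exists_mem_normal_block N hF t k
  let γ : D →ₗ[R] F := LinearMap.fst R F D ∘ₗ c.toLinearMap ∘ₗ LinearMap.inr R F D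
  have key : LinearEquiv.prodCongr (t⁻¹ * k * t * k⁻¹) (LinearEquiv.refl R D) =
      (transvectionEquiv γ)⁻¹ * c := by
    rw [eq_inv_mul_iff_mul_eq]
    ext1 p
    obtain ⟨x, d⟩ := p
    have h3 : ((x, d) : F × D) = (x, 0) + (0, d) := by simp
    have h4 : c (0, d) = (γ d, d) := Prod.ext rfl (h2 _)
    rw [h3, map_add c, h1, h4, ← h3]
    change (_, _) = _
    simp
  rw [key]
  exact N.mul_mem (N.inv_mem (transvectionEquiv_mem_normal N hF e γ)) hc

/-- The commutator acts as `β` on a copy of `D` inside `F`. Conjugating by the swap `θ` of that copy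
with the factor `D` moves `β` there. -/
theorem prodCongr_mem_normal {Q Y : Type*} [AddCommGroup Q] [Module R Q]
    [AddCommGroup Y] [Module R Y] (e : F ≃ₗ[R] Q × Q) (m : F ≃ₗ[R] D × Y) (β : D ≃ₗ[R] D)
    (t k : F ≃ₗ[R] F) (hm : ∀ x, m ((t⁻¹ * k * t * k⁻¹) x) = (β (m x).1, (m x).2)) :
    LinearEquiv.prodCongr (LinearEquiv.refl R F) β ∈ N := by
  let f : (F × D) →ₗ[R] F × D :=
    { toFun := fun p => (m.symm (p.2, (m p.1).2), (m p.1).1)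
      map_add' := fun p q => by
        ext
        · change m.symm _ = m.symm _ + m.symm _
          rw [← map_add]
          simp
        · simp
      map_smul' := fun c p => by
        ext
        · change m.symm _ = c • m.symm _
          rw [← map_smul]
          simp
        · simp }
  have hf : ∀ p, f p = (m.symm (p.2, (m p.1).2), (m p.1).1) := fun p => rfl
  have hinv : Function.Involutive f := fun p => by simp [hf]
  let θ := LinearEquiv.ofInvolutive f hinv
  have hθ : ∀ p, θ p = (m.symm (p.2, (m p.1).2), (m p.1).1) := fun p => rfl
  have key : LinearEquiv.prodCongr (LinearEquiv.refl R F) β =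
      θ * LinearEquiv.prodCongr (t⁻¹ * k * t * k⁻¹) (LinearEquiv.refl R D) * θ⁻¹ := by
    rw [eq_mul_inv_iff_mul_eq]
    ext1 p
    change (_, β (θ p).2) = θ ((t⁻¹ * k * t * k⁻¹) p.1, p.2)
    rw [hθ, hθ, hm]
    rfl
  rw [key]
  exact hN.conj_mem _ (prodCongr_commutator_mem_normal N hF e t k) _

/-- Such a `g` is block triangular with identity on `F`: a transvection followed by an automorphism
of `D`. -/
theorem mem_normal_of_fixes {Q : Type*} [AddCommGroup Q] [Module R Q] (e : F ≃ₗ[R] Q × Q)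
    (hβ : ∀ β : D ≃ₗ[R] D, LinearEquiv.prodCongr (LinearEquiv.refl R F) β ∈ N)
    (g : (F × D) ≃ₗ[R] F × D) (hg : ∀ x, g (x, 0) = (x, 0)) : g ∈ N := by
  have hg' : ∀ x, g.symm (x, 0) = (x, 0) := fun x => by
    rw [LinearEquiv.symm_apply_eq, hg]
  have h1 : ∀ (g : (F × D) ≃ₗ[R] F × D) (hg : ∀ x, g (x, 0) = (x, 0)) p,
      (g p).2 = (g (0, p.2)).2 := fun g hg p => by
    have : p = (p.1, 0) + (0, p.2) := by simp
    conv_lhs => rw [this, map_add, hg]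
    simp
  let β : D ≃ₗ[R] D := LinearEquiv.ofLinearMap
    (LinearMap.snd R F D ∘ₗ g.toLinearMap ∘ₗ LinearMap.inr R F D)
    (LinearMap.snd R F D ∘ₗ g.symm.toLinearMap ∘ₗ LinearMap.inr R F D)
    (LinearMap.ext fun d => by
      change (g (0, (g.symm (0, d)).2)).2 = d
      rw [← h1 g hg, g.apply_symm_apply])
    (LinearMap.ext fun d => by
      change (g.symm (0, (g (0, d)).2)).2 = d
      rw [← h1 g.symm hg', g.symm_apply_apply])
  let α : D →ₗ[R] F := LinearMap.fst R F D ∘ₗ g.toLinearMap ∘ₗ LinearMap.inr R F D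
  have key : g = LinearEquiv.prodCongr (LinearEquiv.refl R F) β * transvectionEquiv α := by
    ext1 p
    change g p = (p.1 + (g (0, p.2)).1, (g (0, p.2)).2)
    have : p = (p.1, 0) + (0, p.2) := by simp
    conv_lhs => rw [this, map_add, hg]
    ext <;> simp
  rw [key]
  exact N.mul_mem (hβ β) (transvectionEquiv_mem_normal N hF e α)

end Blocks

/-! ### The swindle, and normal generation by a moving automorphism. -/

/-- The Eilenberg swindle: every automorphism of `D`, extended by the identity, is a commutator. -/
theorem exists_commutator_eq_prodCongr {R : Type*} [CommRing R] {D E : Type*} [AddCommGroup D]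
    [Module R D] [AddCommGroup E] [Module R E] (β : D ≃ₗ[R] D) (v : E ≃ₗ[R] E)
    (s : (D × E) ≃ₗ[R] E) (hs : ∀ d e, s (β d, v e) = v (s (d, e))) :
    ∃ t k : (D × (E × E)) ≃ₗ[R] D × (E × E), ∀ z, (t⁻¹ * k * t * k⁻¹) z = (β z.1, z.2) := by
  -- A two-sided shift: `d` is pushed onto the first sequence and replaced by the head of the
  -- second. Conjugating `v` on the first sequence by `t` gives `β` on `D` and `v` on `E`; then
  -- `k⁻¹` cancels `v`.
  let t : (D × (E × E)) ≃ₗ[R] D × (E × E) :=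
    { toFun := fun z => ((s.symm z.2.2).1, s (z.1, z.2.1), (s.symm z.2.2).2)
      invFun := fun z => ((s.symm z.2.1).1, (s.symm z.2.1).2, s (z.1, z.2.2))
      map_add' := fun z z' => by
        refine Prod.ext (by simp) (Prod.ext ?_ (by simp))
        simp [← map_add]
      map_smul' := fun c z => by
        refine Prod.ext (by simp) (Prod.ext ?_ (by simp))
        simp [← map_smul]
      left_inv := fun z => by simp
      right_inv := fun z => by simp }
  let k : (D × (E × E)) ≃ₗ[R] D × (E × E) :=
    LinearEquiv.prodCongr (LinearEquiv.refl R D) (LinearEquiv.prodCongr v (LinearEquiv.refl R E))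
  refine ⟨t, k, fun z => ?_⟩
  obtain ⟨d, e, e'⟩ := z
  change t.symm (k (t (d, v.symm e, e'))) = (β d, e, e')
  rw [LinearEquiv.symm_apply_eq]
  change ((s.symm e').1, v (s (d, v.symm e)), (s.symm e').2) =
    ((s.symm e').1, s (β d, e), (s.symm e').2)
  rw [← hs, v.apply_symm_apply]

/-- Prepending a term to a finitely supported sequence. -/
theorem exists_cons_equiv {R : Type*} [CommRing R] {D : Type*} [AddCommGroup D] [Module R D]
    (β : D ≃ₗ[R] D) : ∃ (s : (D × (ℕ →₀ D)) ≃ₗ[R] (ℕ →₀ D)) (v : (ℕ →₀ D) ≃ₗ[R] (ℕ →₀ D)),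
      ∀ d e, s (β d, v e) = v (s (d, e)) := by
  let s : (D × (ℕ →₀ D)) ≃ₗ[R] (ℕ →₀ D) :=
    { toFun := fun p => Finsupp.single 0 p.1 + Finsupp.mapDomain Nat.succ p.2
      invFun := fun f => (f 0, Finsupp.comapDomain Nat.succ f Nat.succ_injective.injOn)
      map_add' := fun p q => by
        simp only [Prod.fst_add, Prod.snd_add, Finsupp.single_add, Finsupp.mapDomain_add]
        abel
      map_smul' := fun c p => by simp [Finsupp.mapDomain_smul]
      left_inv := fun p => by
        refine Prod.ext ?_ (Finsupp.ext fun n => ?_)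
        · simp [Finsupp.mapDomain_of_notMem_range]
        · simp [Finsupp.mapDomain_apply Nat.succ_injective]
      right_inv := fun f => by
        ext n
        rcases n with _ | n
        · simp [Finsupp.mapDomain_of_notMem_range]
        · simp [Finsupp.mapDomain_apply Nat.succ_injective] }
  refine ⟨s, Finsupp.mapRange.linearEquiv β, fun d e => ?_⟩
  change Finsupp.single 0 (β d) + Finsupp.mapDomain Nat.succ _ =
    Finsupp.mapRange.linearEquiv β (Finsupp.single 0 d + Finsupp.mapDomain Nat.succ e)
  ext n
  rcases n with _ | n
  · simp [Finsupp.mapDomain_of_notMem_range]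
  · simp [Finsupp.mapDomain_apply Nat.succ_injective]

/-- A free module of infinite rank splits so that `φ` maps the first of three copies of the module
identically onto the second. -/
theorem MovesSummand.exists_equiv {R : Type v} {A : Type u} [CommRing R] [IsDomain R]
    [IsPrincipalIdealRing R] [AddCommGroup A] [Module R A] [Module.Free R A]
    (hA : Cardinal.aleph0 ≤ Module.rank R A) {φ : A ≃ₗ[R] A} (hφ : MovesSummand φ) :
    ∃ e : (A × (A × A)) ≃ₗ[R] A, ∀ x, φ (e (x, 0, 0)) = e (0, x, 0) := by
  obtain ⟨a, r, ha, hr⟩ := hφ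
  obtain ⟨σ⟩ : Nonempty (A ≃ₗ[R] A × A) := nonempty_linearEquiv_of_rank_eq (by
    rw [rank_prod', Cardinal.add_eq_self hA])
  -- Only half of the given summand is used; the other half lies in `ker r₁`, so the complement has
  -- full rank.
  let a₁ : A →ₗ[R] A := a ∘ₗ σ.symm.toLinearMap ∘ₗ LinearMap.inl R A A
  let r₁ : A →ₗ[R] A × A := LinearMap.prod
    (LinearMap.fst R A A ∘ₗ σ.toLinearMap ∘ₗ LinearMap.fst R A A ∘ₗ r)
    (LinearMap.fst R A A ∘ₗ σ.toLinearMap ∘ₗ LinearMap.snd R A A ∘ₗ r)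
  have h1 : ∀ x, r₁ (a₁ x) = (x, 0) := fun x => by simp [r₁, a₁, ha]
  have h2 : ∀ x, r₁ (φ (a₁ x)) = (0, x) := fun x => by simp [r₁, a₁, hr]
  have hfree : Module.Free R (LinearMap.ker r₁) := Submodule.free_of_isPrincipalIdealRing _
  obtain ⟨c⟩ : Nonempty (A ≃ₗ[R] LinearMap.ker r₁) := nonempty_linearEquiv_of_rank_eq (by
    refine le_antisymm ?_ (Submodule.rank_le _)
    let a₂ : A →ₗ[R] LinearMap.ker r₁ :=
      (a ∘ₗ σ.symm.toLinearMap ∘ₗ LinearMap.inr R A A).codRestrict _ fun x => by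
        simp [r₁, ha]
    refine LinearMap.rank_le_of_injective a₂ fun x y hxy => ?_
    have h3 : a (σ.symm (0, x)) = a (σ.symm (0, y)) := congrArg Subtype.val hxy
    have h4 := congrArg Prod.fst (congrArg r h3)
    rw [ha, ha] at h4
    exact congrArg Prod.snd (σ.symm.injective h4))
  let Θ : (A × (A × A)) →ₗ[R] A := a₁.coprod
    ((φ.toLinearMap ∘ₗ a₁).coprod ((LinearMap.ker r₁).subtype ∘ₗ c.toLinearMap))
  have hΘ : ∀ z, Θ z = a₁ z.1 + (φ (a₁ z.2.1) + (c z.2.2 : A)) := fun z => rfl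
  have hrΘ : ∀ z, r₁ (Θ z) = (z.1, z.2.1) := fun z => by
    rw [hΘ, map_add, map_add, h1, h2, (c z.2.2).2]
    simp
  have hbij : Function.Bijective Θ := by
    constructor
    · rw [← LinearMap.ker_eq_bot, LinearMap.ker_eq_bot']
      intro z hz
      have h3 := hrΘ z
      rw [hz, map_zero] at h3
      have h4 : z.1 = 0 := (congrArg Prod.fst h3).symm
      have h5 : z.2.1 = 0 := (congrArg Prod.snd h3).symm
      have h6 : (c z.2.2 : A) = 0 := by
        rw [hΘ, h4, h5] at hz
        simpa using hz
      have h7 : z.2.2 = 0 := by simpa using h6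
      exact Prod.ext h4 (Prod.ext h5 h7)
    · intro y
      have hk : y - (a₁ (r₁ y).1 + φ (a₁ (r₁ y).2)) ∈ LinearMap.ker r₁ := by
        simp [h1, h2]
      refine ⟨((r₁ y).1, (r₁ y).2, c.symm ⟨_, hk⟩), ?_⟩
      rw [hΘ]
      simp only [LinearEquiv.apply_symm_apply]
      abel
  refine ⟨LinearEquiv.ofBijective Θ hbij, fun x => ?_⟩
  rw [LinearEquiv.ofBijective_apply, LinearEquiv.ofBijective_apply, hΘ, hΘ]
  simp

/-- Transport of automorphisms along an isomorphism. -/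
def LinearEquiv.conjMonoidHom {R A B : Type*} [CommRing R] [AddCommGroup A] [Module R A]
    [AddCommGroup B] [Module R B] (e : B ≃ₗ[R] A) : (B ≃ₗ[R] B) →* (A ≃ₗ[R] A) where
  toFun g := e.symm.trans (g.trans e)
  map_one' := by ext; simp
  map_mul' g h := by ext; simp

theorem LinearEquiv.conjMonoidHom_apply {R A B : Type*} [CommRing R] [AddCommGroup A] [Module R A]
    [AddCommGroup B] [Module R B] (e : B ≃ₗ[R] A) (g : B ≃ₗ[R] B) (x : A) :
    e.conjMonoidHom g x = e (g (e.symm x)) := rfl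

/-- Let `G` act as `t` on the second copy. Then `φ⁻¹ G φ G⁻¹` acts as `t` on the first, so `N`
induces every automorphism there. The swindle, run inside the first copy, then supplies all
automorphisms of the complement. -/
theorem mem_normal_of_fixes_of_maps {R : Type v} {A : Type u} [CommRing R] [IsDomain R]
    [AddCommGroup A] [Module R A] [Module.Free R A]
    (hA : Cardinal.aleph0 ≤ Module.rank R A) (N : Subgroup ((A × (A × A)) ≃ₗ[R] A × (A × A)))
    [hN : N.Normal] (φ : (A × (A × A)) ≃ₗ[R] A × (A × A)) (hφN : φ ∈ N)
    (hφ : ∀ x, φ (x, 0, 0) = (0, x, 0)) (g : (A × (A × A)) ≃ₗ[R] A × (A × A))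
    (hg : ∀ x, g (x, 0) = (x, 0)) : g ∈ N := by
  have hF : ∀ t : A ≃ₗ[R] A, ∃ h ∈ N, ∀ x, h (x, 0) = (t x, 0) := fun t => by
    let G : (A × (A × A)) ≃ₗ[R] A × (A × A) :=
      LinearEquiv.prodCongr (LinearEquiv.refl R A) (LinearEquiv.prodCongr t (LinearEquiv.refl R A))
    refine ⟨φ⁻¹ * (G * φ * G⁻¹), N.mul_mem (N.inv_mem hφN) (hN.conj_mem _ hφN _), fun x => ?_⟩
    change φ.symm (G (φ (x, t.symm 0, 0))) = (t x, 0, 0)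
    rw [LinearEquiv.symm_apply_eq, map_zero, hφ, hφ]
    rfl
  obtain ⟨σ⟩ : Nonempty (A ≃ₗ[R] A × A) := nonempty_linearEquiv_of_rank_eq (by
    rw [rank_prod', Cardinal.add_eq_self hA])
  refine mem_normal_of_fixes N hF σ (fun β => ?_) g hg
  obtain ⟨s, v, hs⟩ := exists_cons_equiv β
  obtain ⟨t, k, htk⟩ := exists_commutator_eq_prodCongr β v s hs
  let E := ℕ →₀ A × A
  obtain ⟨m⟩ : Nonempty (A ≃ₗ[R] (A × A) × (E × E)) := nonempty_linearEquiv_of_rank_eq (by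
    have h2 : Module.rank R (A × A) = Module.rank R A := by
      rw [rank_prod', Cardinal.add_eq_self hA]
    have hE : Module.rank R E = Module.rank R A := by
      simp only [E]
      rw [rank_finsupp, h2]
      simpa using Cardinal.aleph0_mul_eq hA
    rw [rank_prod', h2, rank_prod', hE, Cardinal.add_eq_self hA, Cardinal.add_eq_self hA])
  refine prodCongr_mem_normal N hF σ m β (m.symm.conjMonoidHom t) (m.symm.conjMonoidHom k)
    fun x => ?_
  rw [← map_inv, ← map_inv, ← map_mul, ← map_mul, ← map_mul, LinearEquiv.conjMonoidHom_apply,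
    htk]
  simp

/-- Conjugating `g` to match the decompositions makes it agree with `φ` on the first copy, so their
quotient fixes that copy pointwise. -/
theorem MovesSummand.mem_normal {R : Type v} {A : Type u} [CommRing R] [IsDomain R]
    [IsPrincipalIdealRing R] [AddCommGroup A] [Module R A] [Module.Free R A]
    (hA : Cardinal.aleph0 ≤ Module.rank R A) (N : Subgroup (A ≃ₗ[R] A)) [hN : N.Normal]
    {φ g : A ≃ₗ[R] A} (hφN : φ ∈ N) (hφ : MovesSummand φ) (hg : MovesSummand g) : g ∈ N := by
  obtain ⟨e, he⟩ := hφ.exists_equiv hA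
  obtain ⟨e', he'⟩ := hg.exists_equiv hA
  let k : A ≃ₗ[R] A := e'.symm.trans e
  have hk : ∀ z, k (e' z) = e z := fun z => by simp [k]
  have hk' : ∀ z, k.symm (e z) = e' z := fun z => by simp [k]
  let φ' := e.symm.conjMonoidHom φ
  let g' := e.symm.conjMonoidHom (k * g * k⁻¹)
  have hφ' : ∀ x, φ' (x, 0, 0) = (0, x, 0) := fun x => by
    change e.symm (φ (e (x, 0, 0))) = _
    rw [he, LinearEquiv.symm_apply_apply]
  have hg' : ∀ x, g' (x, 0, 0) = (0, x, 0) := fun x => by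
    change e.symm (k (g (k.symm (e (x, 0, 0))))) = _
    rw [hk', he', hk, LinearEquiv.symm_apply_apply]
  have hinv : ∀ ψ, e.conjMonoidHom (e.symm.conjMonoidHom ψ) = ψ := fun ψ => by
    ext x
    simp [LinearEquiv.conjMonoidHom_apply]
  have hφ'N : φ' ∈ N.comap e.conjMonoidHom := by
    rw [Subgroup.mem_comap, hinv]
    exact hφN
  have h1 : φ'⁻¹ * g' ∈ N.comap e.conjMonoidHom := by
    refine mem_normal_of_fixes_of_maps hA _ φ' hφ'N hφ' _ fun x => ?_
    change φ'.symm (g' (x, 0, 0)) = (x, 0, 0)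
    rw [hg', LinearEquiv.symm_apply_eq, hφ']
  have h2 : g' ∈ N.comap e.conjMonoidHom := by
    have := Subgroup.mul_mem _ hφ'N h1
    rwa [mul_inv_cancel_left] at this
  rw [Subgroup.mem_comap, hinv] at h2
  have h3 := hN.conj_mem _ h2 k⁻¹
  simpa [mul_assoc] using h3

theorem MovesSummand.isNormalGenerator {R : Type v} {A : Type u} [CommRing R] [IsDomain R]
    [IsPrincipalIdealRing R] [AddCommGroup A] [Module R A] [Module.Free R A]
    (hA : Cardinal.aleph0 ≤ Module.rank R A) {φ : A ≃ₗ[R] A} (hφ : MovesSummand φ) :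
    IsNormalGenerator φ := by
  have hinf : Infinite (Module.Free.ChooseBasisIndex R A) := by
    rw [Cardinal.infinite_iff, (Module.Free.chooseBasis R A).mk_eq_rank'']
    exact hA
  rw [IsNormalGenerator, eq_top_iff]
  rintro ψ -
  obtain ⟨g, n, rfl, hg, hn⟩ := exists_mul_eq_movesSummand (Module.Free.chooseBasis R A) ψ
  have hmem : φ ∈ Subgroup.normalClosure {φ} := Subgroup.subset_normalClosure rfl
  exact Subgroup.mul_mem _ (MovesSummand.mem_normal hA _ hmem hφ hg)
    (MovesSummand.mem_normal hA _ hmem hφ hn)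

/-! ### The congruence subgroups: normal and proper. -/

section Large

variable {R : Type v} {A : Type u} [CommRing R] [IsDomain R] [IsPrincipalIdealRing R]
  [AddCommGroup A] [Module R A] [Module.Free R A]

theorem free_quotient_of_isCompl {L V : Submodule R A} (h : IsCompl L V) :
    Module.Free R (A ⧸ L) :=
  have := Submodule.free_of_isPrincipalIdealRing V
  Module.Free.of_equiv (Submodule.quotientEquivOfIsCompl L V h).symm

/-- Large direct summands are closed under intersection. -/
theorem exists_isCompl_inf_and_rank_lt (hA : Cardinal.aleph0 ≤ Module.rank R A)
    {L M : Submodule R A} (hL : ∃ V, IsCompl L V)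
    (hL' : Module.rank R (A ⧸ L) < Module.rank R A) (hM : ∃ V, IsCompl M V)
    (hM' : Module.rank R (A ⧸ M) < Module.rank R A) :
    (∃ V, IsCompl (L ⊓ M) V) ∧ Module.rank R (A ⧸ (L ⊓ M)) < Module.rank R A := by
  have := free_quotient_of_isCompl hL.choose_spec
  have := free_quotient_of_isCompl hM.choose_spec
  have hker : LinearMap.ker (L.mkQ.prod M.mkQ) = L ⊓ M := by
    rw [LinearMap.ker_prod, Submodule.ker_mkQ, Submodule.ker_mkQ]
  rw [← hker]
  refine ⟨?_, ?_⟩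
  · obtain ⟨π, hπ⟩ := exists_projection_ker (L.mkQ.prod M.mkQ)
    exact ⟨_, LinearMap.isCompl_of_proj hπ⟩
  · have h1 := lift_rank_quotient_ker_le (L.mkQ.prod M.mkQ)
    rw [Cardinal.lift_le] at h1
    refine lt_of_le_of_lt h1 ?_
    rw [rank_prod']
    exact Cardinal.add_lt_of_lt hA hL' hM'

omit [IsDomain R] [IsPrincipalIdealRing R] [Module.Free R A] in
theorem exists_isCompl_map_and_rank_lt (g : A ≃ₗ[R] A)
    {L : Submodule R A} (hL : ∃ V, IsCompl L V)
    (hL' : Module.rank R (A ⧸ L) < Module.rank R A) :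
    (∃ V, IsCompl (L.map g.toLinearMap) V) ∧
      Module.rank R (A ⧸ L.map g.toLinearMap) < Module.rank R A := by
  constructor
  · obtain ⟨V, hV⟩ := hL
    exact ⟨_, (Submodule.orderIsoMapComap g).isCompl hV⟩
  · rwa [← LinearEquiv.rank_eq (Submodule.Quotient.equiv L (L.map g.toLinearMap) g rfl)]

/-- A homomorphism from a module of large rank maps some unimodular vector into a given large
direct summand. -/
theorem exists_unimodular_map_mem {B : Type u} [AddCommGroup B] [Module R B] [Module.Free R B]
    (f : B →ₗ[R] A) (hB : Module.rank R A ≤ Module.rank R B) {L : Submodule R A}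
    (hL : ∃ V, IsCompl L V) (hL' : Module.rank R (A ⧸ L) < Module.rank R A) :
    ∃ w, f w ∈ L ∧ ∃ l : B →ₗ[R] R, l w = 1 := by
  have := free_quotient_of_isCompl hL.choose_spec
  obtain ⟨w, hw, hl⟩ := exists_unimodular_mem_ker (L.mkQ ∘ₗ f)
    (Cardinal.lift_lt.2 (hL'.trans_le hB))
  exact ⟨w, by simpa using hw, hl⟩

/-- The automorphisms that agree with a scalar modulo a maximal ideal `(p)` on a large direct
summand form a subgroup. -/
def scalarModOnLarge (hA : Cardinal.aleph0 ≤ Module.rank R A) (p : R)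
    (hp : (Ideal.span {p}).IsMaximal) : Subgroup (A ≃ₗ[R] A) where
  carrier := {φ | IsScalarModOnLarge p φ}
  one_mem' := ⟨1, ⊤, ⟨⊥, isCompl_top_bot⟩, by
    rw [rank_subsingleton']
    exact Cardinal.aleph0_pos.trans_le hA, fun x _ => ⟨0, by simp⟩⟩
  mul_mem' := by
    rintro φ ψ ⟨k, L, hL, hL', h⟩ ⟨k', L', hM, hM', h'⟩
    obtain ⟨h1, h2⟩ := exists_isCompl_inf_and_rank_lt hA hL hL' hM hM'
    refine ⟨k * k', _, h1, h2, fun x hx => ?_⟩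
    obtain ⟨y, hy⟩ := h x hx.1
    obtain ⟨y', hy'⟩ := h' x hx.2
    refine ⟨k' • y + φ y', ?_⟩
    rw [LinearEquiv.mul_apply, hy', map_add, map_smul, map_smul, hy]
    module
  inv_mem' := by
    rintro φ ⟨k, L, hL, hL', h⟩
    -- Otherwise `φ` would send a unimodular vector of `L` into `pA`, putting that vector itself in
    -- `pA`. So `k` is invertible modulo `p`, and its inverse is the scalar for `φ⁻¹` on `φ(L)`.
    have hk : k ∉ Ideal.span {p} := fun hk => by
      obtain ⟨c, rfl⟩ := Ideal.mem_span_singleton'.1 hk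
      obtain ⟨w, hw, l, hl⟩ := exists_unimodular_map_mem LinearMap.id le_rfl hL hL'
      obtain ⟨y, hy⟩ := h w hw
      rw [mul_comm, mul_smul, ← smul_add] at hy
      have h1 : w = p • φ.symm (c • w + y) := by
        rw [← map_smul, ← hy, LinearEquiv.symm_apply_apply]
      refine hp.ne_top (Ideal.eq_top_of_isUnit_mem _ (Ideal.mem_span_singleton_self p)
        (IsUnit.of_mul_eq_one (l (φ.symm (c • w + y))) ?_))
      rw [← hl, ← smul_eq_mul, ← map_smul, ← h1]
    obtain ⟨k', i, hi, hki⟩ := hp.exists_inv hk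
    obtain ⟨c, rfl⟩ := Ideal.mem_span_singleton'.1 hi
    obtain ⟨h1, h2⟩ := exists_isCompl_map_and_rank_lt φ hL hL'
    refine ⟨k', _, h1, h2, ?_⟩
    rintro _ ⟨z, hz, rfl⟩
    obtain ⟨y, hy⟩ := h z hz
    refine ⟨c • z - k' • y, ?_⟩
    change φ.symm (φ z) = k' • φ z + _
    rw [LinearEquiv.symm_apply_apply, hy]
    calc z = (k' * k + c * p) • z := by rw [hki, one_smul]
      _ = _ := by module

theorem normal_scalarModOnLarge (hA : Cardinal.aleph0 ≤ Module.rank R A) (p : R)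
    (hp : (Ideal.span {p}).IsMaximal) : (scalarModOnLarge hA p hp).Normal where
  conj_mem := by
    rintro φ ⟨k, L, hL, hL', h⟩ g
    obtain ⟨h1, h2⟩ := exists_isCompl_map_and_rank_lt g hL hL'
    refine ⟨k, _, h1, h2, ?_⟩
    rintro _ ⟨z, hz, rfl⟩
    obtain ⟨y, hy⟩ := h z hz
    refine ⟨g y, ?_⟩
    change g (φ (g.symm (g z))) = k • g z + p • g y
    rw [LinearEquiv.symm_apply_apply, hy, map_add, map_smul, map_smul]

/-- The swap of the halves of `A ≅ A × A` is not in it: take a unimodular `w` with `(0, w)` in the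
large summand, and the first components of the congruence put `w` in `pA`. -/
theorem scalarModOnLarge_ne_top (hA : Cardinal.aleph0 ≤ Module.rank R A) (p : R)
    (hp : (Ideal.span {p}).IsMaximal) : scalarModOnLarge hA p hp ≠ ⊤ := by
  intro htop
  obtain ⟨σ⟩ : Nonempty (A ≃ₗ[R] A × A) := nonempty_linearEquiv_of_rank_eq (by
    rw [rank_prod', Cardinal.add_eq_self hA])
  let g : A ≃ₗ[R] A := σ.trans ((LinearEquiv.prodComm R A A).trans σ.symm)
  obtain ⟨k, L, hL, hL', h⟩ : g ∈ scalarModOnLarge hA p hp := by rw [htop]; trivial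
  obtain ⟨w, hw, l, hl⟩ := exists_unimodular_map_mem
    (σ.symm.toLinearMap ∘ₗ LinearMap.inr R A A) le_rfl hL hL'
  obtain ⟨y, hy⟩ := h _ hw
  have h1 := congrArg (fun x => (σ x).1) hy
  have h2 : w = p • (σ y).1 := by simpa [g] using h1
  refine hp.ne_top (Ideal.eq_top_of_isUnit_mem _ (Ideal.mem_span_singleton_self p)
    (IsUnit.of_mul_eq_one (l (σ y).1) ?_))
  rw [← hl, ← smul_eq_mul, ← map_smul, ← h2]

theorem IsNormalGenerator.not_isScalarModOnLarge (hA : Cardinal.aleph0 ≤ Module.rank R A)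
    {φ : A ≃ₗ[R] A} (hφ : IsNormalGenerator φ) {p : R} (hp : (Ideal.span {p}).IsMaximal) :
    ¬ IsScalarModOnLarge p φ := by
  intro h
  have := normal_scalarModOnLarge hA p hp
  refine scalarModOnLarge_ne_top hA p hp (top_le_iff.1 ?_)
  rw [← (hφ : Subgroup.normalClosure {φ} = ⊤)]
  exact Subgroup.normalClosure_le_normal (Set.singleton_subset_iff.2 h)

end Large

/-! ### Translation to summands of abelian groups and the conclusion. -/

/-- The summand formulation of `MovesSummand`. -/
theorem movesSummand_iff {A : Type u} [AddCommGroup A] [Module.Free ℤ A] (φ : A ≃ₗ[ℤ] A) :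
    MovesSummand φ ↔ ∃ W : Submodule ℤ A, IsMoietous W ∧
      Disjoint W (W.map (φ : A →ₗ[ℤ] A)) ∧
      IsDirectSummand (W ⊔ W.map (φ : A →ₗ[ℤ] A)) := by
  constructor
  · rintro ⟨a, r, ha, hr⟩
    have hainj : Function.Injective a := fun x y h => by
      have := congrArg (fun z => (r z).1) h
      simpa [ha] using this
    let ρ₁ := LinearMap.fst ℤ A A ∘ₗ r
    let ρ₂ := LinearMap.snd ℤ A A ∘ₗ r
    let p₁ := a ∘ₗ ρ₁
    let p₂ := φ.toLinearMap ∘ₗ a ∘ₗ ρ₂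
    refine ⟨LinearMap.range a, ⟨?_, ?_, ?_⟩, ?_, ?_⟩
    · refine ⟨_, LinearMap.isCompl_of_proj
        (f := p₁.codRestrict (LinearMap.range a) fun x => LinearMap.mem_range_self _ _) ?_⟩
      rintro ⟨_, x, rfl⟩
      ext
      simp [p₁, ρ₁, ha]
    · exact (LinearEquiv.rank_eq (LinearEquiv.ofInjective a hainj)).symm
    · refine le_antisymm (rank_quotient_le _) ?_
      -- The second component of `r` kills the range of `a` and is still onto, thanks to `φ ∘ a`;
      -- this makes the corank full.
      refine LinearMap.rank_le_of_surjective ((LinearMap.range a).liftQ ρ₂ ?_) ?_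
      · rintro _ ⟨x, rfl⟩
        simp [ρ₂, ha]
      · intro x
        exact ⟨Submodule.Quotient.mk (φ (a x)), by simp [ρ₂, hr]⟩
    · rw [Submodule.disjoint_def]
      rintro _ ⟨x, rfl⟩ ⟨_, ⟨y, rfl⟩, hy⟩
      have h1 := congrArg (fun z => (r z).2) hy
      have h2 : y = 0 := by simpa [ha, hr] using h1
      rw [← hy, h2]
      simp
    · refine ⟨_, LinearMap.isCompl_of_proj
        (f := (p₁ + p₂).codRestrict
          (LinearMap.range a ⊔ (LinearMap.range a).map (φ : A →ₗ[ℤ] A)) fun x =>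
            Submodule.add_mem_sup (LinearMap.mem_range_self a (ρ₁ x))
              (Submodule.mem_map_of_mem (f := (φ : A →ₗ[ℤ] A))
                (LinearMap.mem_range_self a (ρ₂ x)))) ?_⟩
      rintro ⟨x, hx⟩
      obtain ⟨_, ⟨y, rfl⟩, _, ⟨_, ⟨z, rfl⟩, rfl⟩, rfl⟩ := Submodule.mem_sup.1 hx
      ext
      simp [p₁, p₂, ρ₁, ρ₂, ha, hr]
  · rintro ⟨W, ⟨-, hW, -⟩, hdis, V, hV⟩
    have := Submodule.free_of_isPrincipalIdealRing W
    obtain ⟨c⟩ := nonempty_linearEquiv_of_rank_eq hW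
    let a : A →ₗ[ℤ] A := W.subtype ∘ₗ c.symm.toLinearMap
    have haW : ∀ x, a x ∈ W := fun x => (c.symm x).2
    have hainj : Function.Injective a := W.injective_subtype.comp c.symm.injective
    let θ : A × A →ₗ[ℤ] A := a.coprod (φ.toLinearMap ∘ₗ a)
    have hθ : ∀ z, θ z = a z.1 + φ (a z.2) := fun z => rfl
    have hinj : Function.Injective θ := by
      rw [← LinearMap.ker_eq_bot, LinearMap.ker_eq_bot']
      intro z hz
      rw [hθ] at hz
      have h1 : a z.1 ∈ W.map (φ : A →ₗ[ℤ] A) := by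
        rw [eq_neg_of_add_eq_zero_left hz]
        exact Submodule.neg_mem _ (Submodule.mem_map_of_mem (haW _))
      have h2 : a z.1 = 0 := Submodule.disjoint_def.1 hdis _ (haW _) h1
      rw [h2, zero_add] at hz
      have h3 : a z.2 = 0 := by simpa using hz
      exact Prod.ext (hainj (by simpa using h2)) (hainj (by simpa using h3))
    have hrange : LinearMap.range θ = W ⊔ W.map (φ : A →ₗ[ℤ] A) := by
      have h1 : LinearMap.range a = W := by
        simp only [a]
        rw [LinearMap.range_comp, LinearEquiv.range, Submodule.map_top, Submodule.range_subtype]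
      rw [LinearMap.range_coprod, LinearMap.range_comp _ φ.toLinearMap, h1]
    rw [← hrange] at hV
    let r : A →ₗ[ℤ] A × A :=
      (LinearEquiv.ofInjective θ hinj).symm.toLinearMap ∘ₗ Submodule.projectionOnto _ V hV
    have hr : ∀ z, r (θ z) = z := fun z => by
      have h1 : Submodule.projectionOnto _ V hV (θ z) = LinearEquiv.ofInjective θ hinj z :=
        Submodule.projectionOnto_apply_left hV ⟨θ z, LinearMap.mem_range_self _ _⟩
      simp only [r, LinearMap.comp_apply]
      rw [h1]
      exact LinearEquiv.symm_apply_apply _ _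
    refine ⟨a, r, fun x => ?_, fun x => ?_⟩
    · rw [← hr (x, 0), hθ]; simp
    · rw [← hr (0, x), hθ]; simp

theorem mem_lam_of_isScalarModOnLarge {A : Type u} [AddCommGroup A] (φ : A ≃ₗ[ℤ] A) {p : ℤ}
    (h : IsScalarModOnLarge p φ) : φ ∈ Lam A p.natAbs := by
  obtain ⟨k, L, hL, hL', h⟩ := h
  refine ⟨k, L, ⟨hL, hL'⟩, fun x hx => ?_⟩
  obtain ⟨y, hy⟩ := h x hx
  rcases Int.natAbs_eq p with hp | hp
  · exact ⟨y, by rw [hy, ← natCast_zsmul, ← hp]⟩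
  · refine ⟨-y, ?_⟩
    rw [hy, ← natCast_zsmul, smul_neg, ← neg_smul, ← hp]

theorem mainTheorem1 {A : Type*} [AddCommGroup A] [Module.Free ℤ A] (hA : ¬ Module.Finite ℤ A)
    (φ : A ≃ₗ[ℤ] A) :
    (IsNormalGenerator φ ↔
      ∃ W : Submodule ℤ A, IsMoietous W ∧
        Disjoint W (W.map (φ : A →ₗ[ℤ] A)) ∧
        IsDirectSummand (W ⊔ W.map (φ : A →ₗ[ℤ] A))) ∧
    (¬ IsNormalGenerator φ → ∃ m : ℕ, 2 ≤ m ∧ φ ∈ Lam A m) := by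
  have hrank : Cardinal.aleph0 ≤ Module.rank ℤ A := by
    rw [← not_lt, Module.rank_lt_aleph0_iff]
    exact hA
  let b := Module.Free.chooseBasis ℤ A
  have hinf : Infinite (Module.Free.ChooseBasisIndex ℤ A) := by
    rw [Cardinal.infinite_iff, b.mk_eq_rank'']
    exact hrank
  rw [← movesSummand_iff]
  refine ⟨⟨fun h => ?_, fun h => h.isNormalGenerator hrank⟩, fun h => ?_⟩
  · exact movesSummand_of_not_isScalarModOnLarge b φ fun p hp => h.not_isScalarModOnLarge hrank hp
  · by_contra! hcon
    refine h (MovesSummand.isNormalGenerator hrank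
      (movesSummand_of_not_isScalarModOnLarge b φ fun p hp hs => ?_))
    refine hcon p.natAbs ?_ (mem_lam_of_isScalarModOnLarge φ hs)
    -- A maximal ideal of `ℤ` is neither zero nor the unit ideal, so `|p| ≥ 2`.
    have h0 : p ≠ 0 := by
      rintro rfl
      refine Ring.ne_bot_of_isMaximal_of_not_isField hp Int.not_isField (by simp)
    have h1 : ¬ IsUnit p := fun hu => hp.ne_top (Ideal.span_singleton_eq_top.2 hu)
    rw [Int.isUnit_iff_natAbs_eq] at h1
    have := Int.natAbs_ne_zero.2 h0
    omega
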